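/- **Setting.** Let $\theta=\theta(F)$ be an $\mathbb{R}^p$-valued functional of $d$-dimensional distribution functions. For data $x_1,x_2,\dots\in\mathbb{R}^d$ let $\hat F_i^j(z)=\frac1{j-i+1}\sum_{t=i}^j I\{x_t\le z\}$ (componentwise inequality) and $\hat\theta_i^j=\theta(\hat F_i^j)$ for $i\le j$, $\hat\theta_i^j=0$ for $i>j$; these are assumed to be Borel functions of the data. The influence function is $\mathcal{IF}(x,F,\theta)=\lim_{\varepsilon\searrow0}\varepsilon^{-1}\big(\theta((1-\varepsilon)F+\varepsilon\delta_x)-\theta(F)\big)$, with $\delta_x(z)=I\{x\le z\}$. **Assumption.** Let $T>0$ and $1<c<T+1$. Let $\{Z_t(1)\}_{t\in\mathbb{Z}}$ and $\{Z_t(2)\}_{t\in\mathbb{Z}}$ be strictly stationary $\mathbb{R}^d$-valued processes on a common probability space with marginal distribution functions $F^{(1)},F^{(2)}$ such that $\theta(F^{(1)})\ne\theta(F^{(2)})$. For $\ell=1,2$ suppose: * $\mathcal{IF}(x,F^{(\ell)},\theta)$ exists for all $x$, is measurable in $x$, and $\mathcal{IF}(Z_0(\ell),F^{(\ell)},\theta)$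 is square integrable; * the long-run covariance matrix $\Sigma_{F^{(\ell)}}=\sum_{t\in\mathbb{Z}}\mathrm{Cov}\big(\mathcal{IF}(Z_0(\ell),F^{(\ell)},\theta),\mathcal{IF}(Z_t(\ell),F^{(\ell)},\theta)\big)$ exists (as limit of the symmetric partial sums $\sum_{|t|\le N}$) and is positive definite; * the remainders $R^{(\ell)}_{i,j}=\hat\theta_i^j-\theta(F^{(\ell)})-\frac1{j-i+1}\sum_{t=i}^j\mathcal{IF}(Z_t(\ell),F^{(\ell)},\theta)$, with $\hat\theta_i^j$ computed from $Z_i(\ell),\dots,Z_j(\ell)$, satisfy $\sup_{1\le i<j\le n}(j-i+1)|R^{(\ell)}_{i,j}|=o_{\mathbb P}(n^{1/2})$ as $n\to\infty$. Suppose further that there are two standard $p$-dimensional Brownian motions $W_1,W_2$ on a common probability space (not necessarily independent) such that, as $m\to\infty$, $$\left(\Big\{\tfrac1{\sqrt m}\sum_{t=1}^{\lfloor ms\rfloor}\mathcal{IF}(Z_t(1),F^{(1)},\theta)\Big\}_{s\in[0,c]},\ \Big\{\tfrac1{\sqrt m}\sum_{t=\lfloor mc\rfloor+1}^{\lfloor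 ms\rfloor}\mathcal{IF}(Z_t(2),F^{(2)},\theta)\Big\}_{s\in[c,T+1]}\right)$$ converges weakly in $\ell^\infty([0,c],\mathbb{R}^p)\times\ell^\infty([c,T+1],\mathbb{R}^p)$ (sup norms) to $$\left(\big\{\Sigma_{F^{(1)}}^{1/2}W_1(s)\big\}_{s\in[0,c]},\ \big\{\Sigma_{F^{(2)}}^{1/2}(W_2(s)-W_2(c))\big\}_{s\in[c,T+1]}\right).$$ For each $m\in\mathbb{N}$ let the observations $X_t=X_{m,t}$ (a triangular array) satisfy $$(X_1,\dots,X_{\lfloor mc\rfloor})\overset{\mathcal D}{=}(Z_1(1),\dots,Z_{\lfloor mc\rfloor}(1)),\qquad (X_{\lfloor mc\rfloor+1},\dots,X_{\lfloor m(T+1)\rfloor})\overset{\mathcal D}{=}(Z_{\lfloor mc\rfloor+1}(2),\dots,Z_{\lfloor m(T+1)\rfloor}(2)).$$ That is, the alternative $H_1$ holds: the parameter changes once within the observed range, from $\theta(F^{(1)})$ to $\theta(F^{(2)})\neq\theta(F^{(1)})$, after time $\lfloor mc\rfloor$. **Monitoring scheme.** With $\hat\theta_i^j$ computed from $X_1,X_2,\dots$,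 let $$\begin{aligned}\mathbb V(z,u)&=\sum_{j=1}^z j^2(z-j)^2(\hat\theta_1^j-\hat\theta_{j+1}^z)(\hat\theta_1^j-\hat\theta_{j+1}^z)^\top\\&\quad+\sum_{j=z+1}^u(u-j)^2(j-z)^2(\hat\theta_{z+1}^j-\hat\theta_{j+1}^u)(\hat\theta_{z+1}^j-\hat\theta_{j+1}^u)^\top,\end{aligned}$$ $$\hat D^{\rm SN}_m(k)=m\max_{j=0}^{k-1}(m+j)^2(k-j)^2(\hat\theta_1^{m+j}-\hat\theta_{m+j+1}^{m+k})^\top\,\mathbb V^{-1}(m+j,m+k)\,(\hat\theta_1^{m+j}-\hat\theta_{m+j+1}^{m+k}),$$ where $\mathbb V^{-1}$ is read as $0$ if $\mathbb V$ is singular. **Threshold.** Let $\alpha\in(0,1)$ and let $w_\alpha:[0,T]\to(0,\infty)$ be (weakly) increasing with $$\mathbb P\Big(\sup_{t\in[1,T+1]}\sup_{s\in[1,t]}\frac{|\tilde B(s,t)|}{w_\alpha(t-1)}>1\Big)=\alpha,$$ where, for a standard $p$-dimensional Brownian motion $W$, $B(s,t)=tW(s)-sW(t)$, $\tilde B(s,t)=B(s,t)^\top(N_1(s)+N_2(s,t))^{-1}B(s,t)$,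 $N_1(s)=\int_0^sB(r,s)B(r,s)^\top dr$, and $N_2(s,t)=\int_s^tb(r)b(r)^\top dr$ with $b(r)=B(r,t)+B(s,r)-B(s,t)$. **Theorem.** Under these assumptions the monitoring scheme that rejects at the first $k\in\{1,\dots,\lfloor Tm\rfloor\}$ with $\hat D^{\rm SN}_m(k)>w_\alpha(k/m)$ is consistent: $$\lim_{m\to\infty}\mathbb P\Big(\max_{k=1}^{\lfloor Tm\rfloor}\frac{\hat D^{\rm SN}_m(k)}{w_\alpha(k/m)}>1\Big)=1 .$$ -/

import Mathlib

open MeasureTheory ProbabilityTheory Filter Topology Matrix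
open scoped ENNReal NNReal MatrixOrder

noncomputable section

namespace SeqChange

/-! ### Distribution functions, functionals and influence functions -/

/-- The distribution function `z ↦ P (X ≤ z)` of an `ℝ^d`-valued random vector (componentwise
order). -/
def distFun {d : ℕ} {Ω : Type*} [MeasurableSpace Ω] (P : Measure Ω) (X : Ω → Fin d → ℝ) :
    (Fin d → ℝ) → ℝ :=
  fun z => P.real {ω | X ω ≤ z}

open Classical in
/-- The distribution function of the Dirac measure at `x`. -/
def diracDistFun {d : ℕ} (x : Fin d → ℝ) : (Fin d → ℝ) → ℝ :=
  fun z => if x ≤ z then 1 else 0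

/-- The empirical distribution function of `x i, …, x j`. -/
def empDistFun {d : ℕ} (x : ℕ → Fin d → ℝ) (i j : ℕ) : (Fin d → ℝ) → ℝ :=
  fun z => ((j : ℝ) - i + 1)⁻¹ * ∑ t ∈ Finset.Icc i j, diracDistFun (x t) z

/-- The difference quotient whose limit as `ε ↓ 0` is the influence function. -/
def influenceQuotient {d p : ℕ} (θ : ((Fin d → ℝ) → ℝ) → EuclideanSpace ℝ (Fin p))
    (F : (Fin d → ℝ) → ℝ) (x : Fin d → ℝ) (ε : ℝ) : EuclideanSpace ℝ (Fin p) :=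
  ε⁻¹ • (θ ((1 - ε) • F + ε • diracDistFun x) - θ F)

/-- The influence function of the functional `θ` at the distribution function `F`. -/
def influence {d p : ℕ} (θ : ((Fin d → ℝ) → ℝ) → EuclideanSpace ℝ (Fin p))
    (F : (Fin d → ℝ) → ℝ) (x : Fin d → ℝ) : EuclideanSpace ℝ (Fin p) :=
  limUnder (𝓝[>] (0 : ℝ)) (influenceQuotient θ F x)

/-- The estimator `θ (F̂_i^j)` of the parameter from `x i, …, x j`, equal to `0` if `i > j`. -/
def estimator {d p : ℕ} (θ : ((Fin d → ℝ) → ℝ) → EuclideanSpace ℝ (Fin p))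
    (x : ℕ → Fin d → ℝ) (i j : ℕ) : EuclideanSpace ℝ (Fin p) :=
  if i ≤ j then θ (empDistFun x i j) else 0

/-- The remainder `R_{i,j}` of the linearization of the estimator at `F`. -/
def remainder {d p : ℕ} (θ : ((Fin d → ℝ) → ℝ) → EuclideanSpace ℝ (Fin p))
    (F : (Fin d → ℝ) → ℝ) (x : ℕ → Fin d → ℝ) (i j : ℕ) : EuclideanSpace ℝ (Fin p) :=
  estimator θ x i j - θ F - ((j : ℝ) - i + 1)⁻¹ • ∑ t ∈ Finset.Icc i j, influence θ F (x t)

/-- `sup_{1 ≤ i < j ≤ n} (j - i + 1) |R_{i,j}|` (a maximum over a finite set, `0` if `n ≤ 1`). -/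
def supRemainder {d p : ℕ} (θ : ((Fin d → ℝ) → ℝ) → EuclideanSpace ℝ (Fin p))
    (F : (Fin d → ℝ) → ℝ) (x : ℕ → Fin d → ℝ) (n : ℕ) : ℝ :=
  ⨆ q : {q : Fin (n + 1) × Fin (n + 1) // 1 ≤ (q.1 : ℕ) ∧ (q.1 : ℕ) < (q.2 : ℕ)},
    (((q.1.2 : ℕ) : ℝ) - ((q.1.1 : ℕ) : ℝ) + 1) * ‖remainder θ F x q.1.1 q.1.2‖

/-! ### The monitoring scheme -/

/-- `θ̂_{l+1}^z - θ̂_{z+1}^u`. -/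
def estimatorDiff {d p : ℕ} (θ : ((Fin d → ℝ) → ℝ) → EuclideanSpace ℝ (Fin p))
    (x : ℕ → Fin d → ℝ) (l z u : ℕ) : Fin p → ℝ :=
  (estimator θ x (l + 1) z - estimator θ x (z + 1) u).ofLp

/-- The self-normalizing matrix `𝕍(z, u)`. -/
def selfNormalizer {d p : ℕ} (θ : ((Fin d → ℝ) → ℝ) → EuclideanSpace ℝ (Fin p))
    (x : ℕ → Fin d → ℝ) (z u : ℕ) : Matrix (Fin p) (Fin p) ℝ :=
  (∑ j ∈ Finset.Icc 1 z, ((j : ℝ) ^ 2 * ((z : ℝ) - j) ^ 2) •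
      vecMulVec (estimatorDiff θ x 0 j z) (estimatorDiff θ x 0 j z)) +
    ∑ j ∈ Finset.Icc (z + 1) u, (((u : ℝ) - j) ^ 2 * ((j : ℝ) - z) ^ 2) •
      vecMulVec (estimatorDiff θ x z j u) (estimatorDiff θ x z j u)

/-- The self-normalized statistic `D̂^SN_m(k)`, a maximum over `j = 0, …, k - 1`.  The matrix
inverse is `0` at a singular matrix, so such indices contribute the value `0`. -/
def detectorSN {d p : ℕ} (θ : ((Fin d → ℝ) → ℝ) → EuclideanSpace ℝ (Fin p))
    (x : ℕ → Fin d → ℝ) (m k : ℕ) : ℝ :=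
  (m : ℝ) * ⨆ j : Fin k, ((m : ℝ) + (j : ℕ)) ^ 2 * ((k : ℝ) - (j : ℕ)) ^ 2 *
    (estimatorDiff θ x 0 (m + j) (m + k) ⬝ᵥ
      (selfNormalizer θ x (m + j) (m + k))⁻¹ *ᵥ estimatorDiff θ x 0 (m + j) (m + k))

/-- `max_{1 ≤ k ≤ ⌊m T⌋} D̂^SN_m(k) / w(k / m)` (and `0` if `⌊m T⌋ = 0`). -/
def maxDetectorSN {d p : ℕ} (θ : ((Fin d → ℝ) → ℝ) → EuclideanSpace ℝ (Fin p))
    (w : ℝ → ℝ) (T : ℝ) (x : ℕ → Fin d → ℝ) (m : ℕ) : ℝ :=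
  ⨆ i : Fin ⌊(m : ℝ) * T⌋₊,
    detectorSN θ x m ((i : ℕ) + 1) / w ((((i : ℕ) + 1 : ℕ) : ℝ) / m)

/-! ### Brownian motion and the limit in the threshold condition -/

/-- Standard `p`-dimensional Brownian motion: independent coordinates, each of which is a standard
real Brownian motion. -/
structure IsBrownianVec {p : ℕ} {Ω : Type*} [MeasurableSpace Ω]
    (W : ℝ≥0 → Ω → EuclideanSpace ℝ (Fin p)) (P : Measure Ω) : Prop where
  coord : ∀ i, IsBrownianReal (fun t ω => W t ω i) P
  indep : iIndepFun (fun (i : Fin p) (ω : Ω) (t : ℝ≥0) => W t ω i) P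

/-- `B(s, t) = t W(s) - s W(t)`. -/
def bridge {p : ℕ} (W : ℝ≥0 → EuclideanSpace ℝ (Fin p)) (s t : ℝ) : Fin p → ℝ :=
  (t • W s.toNNReal - s • W t.toNNReal).ofLp

/-- `N₁(s) = ∫₀ˢ B(r, s) B(r, s)ᵀ dr`. -/
def normN1 {p : ℕ} (W : ℝ≥0 → EuclideanSpace ℝ (Fin p)) (s : ℝ) : Matrix (Fin p) (Fin p) ℝ :=
  Matrix.of fun i j => ∫ r in (0 : ℝ)..s, bridge W r s i * bridge W r s j

/-- `N₂(s, t) = ∫ₛᵗ b(r) b(r)ᵀ dr` with `b(r) = B(r, t) + B(s, r) - B(s, t)`. -/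
def normN2 {p : ℕ} (W : ℝ≥0 → EuclideanSpace ℝ (Fin p)) (s t : ℝ) :
    Matrix (Fin p) (Fin p) ℝ :=
  Matrix.of fun i j => ∫ r in s..t,
    (bridge W r t + bridge W s r - bridge W s t) i *
      (bridge W r t + bridge W s r - bridge W s t) j

/-- `B̃(s, t) = B(s, t)ᵀ (N₁(s) + N₂(s, t))⁻¹ B(s, t)`. -/
def bTilde {p : ℕ} (W : ℝ≥0 → EuclideanSpace ℝ (Fin p)) (s t : ℝ) : ℝ :=
  bridge W s t ⬝ᵥ (normN1 W s + normN2 W s t)⁻¹ *ᵥ bridge W s t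

/-- `sup_{t ∈ [1, T+1]} sup_{s ∈ [1, t]} |B̃(s, t)| / w(t - 1)`, with values in `[0, ∞]`. -/
def supBTilde {p : ℕ} (W : ℝ≥0 → EuclideanSpace ℝ (Fin p)) (w : ℝ → ℝ) (T : ℝ) : ℝ≥0∞ :=
  ⨆ t ∈ Set.Icc 1 (T + 1), ⨆ s ∈ Set.Icc 1 t, ENNReal.ofReal (|bTilde W s t| / w (t - 1))

/-! ### Weak convergence in spaces of bounded functions -/

/-- The space `ℓ^∞([a, b], ℝ^p)` with the sup norm. -/
abbrev LInf (a b : ℝ) (p : ℕ) : Type :=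
  lp (fun _ : Set.Icc a b => EuclideanSpace ℝ (Fin p)) ∞

open Classical in
/-- The restriction to `[a, b]` of a function that is bounded there, as an element of
`ℓ^∞([a, b], ℝ^p)` (and `0` if the function is unbounded on `[a, b]`). -/
def toLInf {p : ℕ} (a b : ℝ) (f : ℝ → EuclideanSpace ℝ (Fin p)) : LInf a b p :=
  if h : Memℓp (fun s : Set.Icc a b => f s) ∞ then ⟨fun s => f s, h⟩ else 0

theorem toLInf_apply {p : ℕ} {a b : ℝ} {f : ℝ → EuclideanSpace ℝ (Fin p)}
    (h : Memℓp (fun s : Set.Icc a b => f s) ∞) (s : Set.Icc a b) : toLInf a b f s = f s := by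
  simp [toLInf, h]

/-- Continuous paths are bounded on `[a, b]`. -/
theorem memLInf_of_continuousOn {p : ℕ} {a b : ℝ} {f : ℝ → EuclideanSpace ℝ (Fin p)}
    (hf : ContinuousOn f (Set.Icc a b)) : Memℓp (fun s : Set.Icc a b => f s) ∞ := by
  obtain ⟨C, hC⟩ := isCompact_Icc.exists_bound_of_continuousOn hf
  refine memℓp_infty ⟨C, ?_⟩
  rintro _ ⟨s, rfl⟩
  exact hC s s.2

/-- The partial sum `m^{-1/2} ∑_{t = a + 1}^{⌊m s⌋} g t`. -/
def partialSum {p : ℕ} (g : ℕ → EuclideanSpace ℝ (Fin p)) (m a : ℕ) (s : ℝ) :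
    EuclideanSpace ℝ (Fin p) :=
  (√(m : ℝ))⁻¹ • ∑ t ∈ Finset.Ioc a ⌊(m : ℝ) * s⌋₊, g t

/-- Partial sum paths are bounded on `[a, b]`. -/
theorem memLInf_partialSum {p : ℕ} {a b : ℝ} (g : ℕ → EuclideanSpace ℝ (Fin p)) (m l : ℕ) :
    Memℓp (fun s : Set.Icc a b => partialSum g m l s) ∞ := by
  refine memℓp_infty ⟨(√(m : ℝ))⁻¹ * ∑ t ∈ Finset.Ioc l ⌊(m : ℝ) * b⌋₊, ‖g t‖, ?_⟩
  rintro _ ⟨s, rfl⟩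
  simp only [partialSum, norm_smul, norm_inv, Real.norm_eq_abs, abs_of_nonneg (Real.sqrt_nonneg _)]
  gcongr
  refine (norm_sum_le _ _).trans
    (Finset.sum_le_sum_of_subset_of_nonneg ?_ fun _ _ _ => norm_nonneg _)
  refine Finset.Ioc_subset_Ioc_right (Nat.floor_le_floor ?_)
  gcongr
  exact s.2.2

/-- Weak convergence of random elements of a topological space equipped with its Borel
`σ`-algebra. -/
def TendstoWeakly {S : Type*} [TopologicalSpace S] {Ω Ω' : Type*}
    [MeasurableSpace Ω] [MeasurableSpace Ω'] (X : ℕ → Ω → S) (Y : Ω' → S)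
    (P : Measure Ω) [IsProbabilityMeasure P] (P' : Measure Ω') [IsProbabilityMeasure P'] : Prop :=
  letI : MeasurableSpace S := borel S
  haveI : BorelSpace S := ⟨rfl⟩
  TendstoInDistribution X atTop Y (fun _ => P) P'

/-! ### The regimes before and after the change -/

/-- The matrix `Cov(IF(Z_0, F, θ), IF(Z_t, F, θ))`. -/
def influenceCov {d p : ℕ} {Ω : Type*} [MeasurableSpace Ω]
    (θ : ((Fin d → ℝ) → ℝ) → EuclideanSpace ℝ (Fin p)) (F : (Fin d → ℝ) → ℝ)
    (Z : ℤ → Ω → Fin d → ℝ) (P : Measure Ω) (t : ℤ) : Matrix (Fin p) (Fin p) ℝ :=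
  Matrix.of fun i j =>
    cov[fun ω => influence θ F (Z 0 ω) i, fun ω => influence θ F (Z t ω) j; P]

/-- `Z` is a strictly stationary process with marginal distribution function `F`, the influence
function of `θ` at `F` exists and is square integrable along `Z`, its long-run covariance matrix
is the positive definite matrix `Sig`, and the remainders of the linearization of the estimators
are uniformly negligible: `sup_{1 ≤ i < j ≤ n} (j - i + 1) |R_{i,j}| = o_P(n^{1/2})`. -/
structure IsRegime {d p : ℕ} {Ω : Type*} [MeasurableSpace Ω]
    (θ : ((Fin d → ℝ) → ℝ) → EuclideanSpace ℝ (Fin p)) (F : (Fin d → ℝ) → ℝ)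
    (Sig : Matrix (Fin p) (Fin p) ℝ) (Z : ℤ → Ω → Fin d → ℝ) (P : Measure Ω) : Prop where
  stationary : ∀ h : ℤ, IdentDistrib (fun ω t => Z t ω) (fun ω t => Z (t + h) ω) P P
  marginal : distFun P (Z 0) = F
  influence_exists : ∀ x, ∃ y, Tendsto (influenceQuotient θ F x) (𝓝[>] (0 : ℝ)) (𝓝 y)
  influence_measurable : Measurable (influence θ F)
  influence_memLp : MemLp (fun ω => influence θ F (Z 0 ω)) 2 P
  longRun : Tendsto (fun N : ℕ => ∑ t ∈ Finset.Icc (-(N : ℤ)) N, influenceCov θ F Z P t) atTop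
    (𝓝 Sig)
  posDef : Sig.PosDef
  remainder_small : TendstoInMeasure P
    (fun (n : ℕ) ω => supRemainder θ F (fun t => Z t ω) n / √(n : ℝ)) atTop (fun _ => 0)

/-- The pair of partial sum processes of the influence functions before the change (on `[0, c]`)
and after the change (on `[c, T + 1]`). -/
def partialSumPair {d p : ℕ} {Ω : Type*} (θ : ((Fin d → ℝ) → ℝ) → EuclideanSpace ℝ (Fin p))
    (F₁ F₂ : (Fin d → ℝ) → ℝ) (Z₁ Z₂ : ℤ → Ω → Fin d → ℝ) (c T : ℝ) (m : ℕ) (ω : Ω) :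
    LInf 0 c p × LInf c (T + 1) p :=
  (toLInf 0 c (partialSum (fun t => influence θ F₁ (Z₁ t ω)) m 0),
    toLInf c (T + 1)
      (partialSum (fun t => influence θ F₂ (Z₂ t ω)) m ⌊(m : ℝ) * c⌋₊))

/-- The pair of limit processes `√Σ₁ W₁(s)`, `s ∈ [0, c]`, and `√Σ₂ (W₂(s) - W₂(c))`,
`s ∈ [c, T + 1]`. -/
def limitPair {p : ℕ} {Ω : Type*} (Sig₁ Sig₂ : Matrix (Fin p) (Fin p) ℝ)
    (W₁ W₂ : ℝ≥0 → Ω → EuclideanSpace ℝ (Fin p)) (c T : ℝ) (ω : Ω) :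
    LInf 0 c p × LInf c (T + 1) p :=
  (toLInf 0 c fun s => Matrix.toEuclideanLin (CFC.sqrt Sig₁) (W₁ s.toNNReal ω),
    toLInf c (T + 1) fun s =>
      Matrix.toEuclideanLin (CFC.sqrt Sig₂) (W₂ s.toNNReal ω - W₂ c.toNNReal ω))

end SeqChange

end

namespace SeqChange

/-! ### Linear independence of independent random vectors -/

/-! A single entry of the double maximum already explodes: the last monitoring time `k = ⌊mT⌋`, with
the candidate split at the true change point `z = ⌊mc⌋`. Put `u = m + k = ⌊m(T+1)⌋`. For this split
both sums in `𝕍(z, u)` compare estimators from within one stationary regime, so the jump of the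
parameter cancels. By linearization and tightness of the partial sums, each weighted difference is
`O_P(m^{3/2})`, whence `𝕍(z, u) = O_P(m⁴)` as a quadratic form. The two block estimators converge to
distinct parameters, and the prefactor `m z² (u - z)²` has order `m⁵`. The entry is therefore at
least a constant times `m`, with probability near one, while the threshold never exceeds `w T`. The
deterministic side is `le_detectorSN` and `one_lt_maxDetectorSN`; the stochastic bounds are
`IsRegime.exists_eventually_blockGood`.

An upper bound on `𝕍` does not suffice, because a singular `𝕍` contributes `0`. Nonsingularity comes
from the pre-change sum alone: it is enough that `p` of its vectors are linearly independent. After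
rescaling, the vectors at `p` equidistant grid points converge in law to an invertible matrix
applied to Brownian bridge values. These are almost surely independent
(`ae_linearIndependent_gridBridge`), and since independence is an open condition it passes to the
approximations with high probability (`IsRegime.eventually_linearIndependent_blockVec`).

Each good event depends on one block of observations only. It is transferred from the stationary
processes to the array by equality of block laws, and a union bound finishes; the dependence between
the blocks plays no role. -/

theorem ae_linearIndependent_pi {E : Type*} [NormedAddCommGroup E] [NormedSpace ℝ E]
    [FiniteDimensional ℝ E] [MeasurableSpace E] [BorelSpace E] {n : ℕ} (μ : Fin n → Measure E)
    [∀ i, IsProbabilityMeasure (μ i)] (hμ : ∀ i (S : Submodule ℝ E), S ≠ ⊤ → μ i S = 0)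
    (hn : n ≤ Module.finrank ℝ E) : ∀ᵐ x ∂Measure.pi μ, LinearIndependent ℝ x := by
  have : ProperSpace E := FiniteDimensional.proper ℝ E
  have : SecondCountableTopology E := inferInstance
  induction n with
  | zero => exact ae_of_all _ fun x => linearIndependent_empty_type
  | succ n ih =>
    have hmp := measurePreserving_piFinSuccAbove μ 0
    have hopen : MeasurableSet {x : Fin (n + 1) → E | LinearIndependent ℝ x} :=
      isOpen_setOfPred_linearIndependent.measurableSet
    set e := MeasurableEquiv.piFinSuccAbove (fun _ : Fin (n + 1) => E) 0
    have hset : MeasurableSet {q : E × (Fin n → E) | LinearIndependent ℝ (e.symm q)} :=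
      e.symm.measurable hopen
    have hcons : ∀ q : E × (Fin n → E), e.symm q = Fin.cons q.1 q.2 := fun q => by
      ext i
      simp [e, MeasurableEquiv.piFinSuccAbove, Fin.insertNthEquiv]
    have key : ∀ᵐ q ∂((μ 0).prod (Measure.pi fun j => μ (Fin.succAbove 0 j))),
        LinearIndependent ℝ (e.symm q) := by
      -- Fubini with the tail vectors fixed first: they span at most `n < dim E` dimensions, so the
      -- span is proper and null for the law of the remaining vector.
      rw [Measure.ae_prod_iff_ae_ae hset, Measure.ae_ae_comm hset]
      filter_upwards [ih (fun j => μ (Fin.succAbove 0 j)) (fun j => hμ _) (by omega)] with v hv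
      have hS : Submodule.span ℝ (Set.range v) ≠ ⊤ := by
        intro h
        have h1 := finrank_range_le_card (R := ℝ) v
        rw [Set.finrank, h, finrank_top, Fintype.card_fin] at h1
        omega
      have h0 := hμ 0 _ hS
      filter_upwards [measure_eq_zero_iff_ae_notMem.1 h0] with x hx
      rw [hcons, linearIndependent_finCons]
      exact ⟨hv, hx⟩
    have := hmp.quasiMeasurePreserving.ae key
    filter_upwards [this] with x hx
    simpa using hx

/-! ### Brownian motion on a grid -/

/-- The values of a path on the grid `h, …, n h`, in bridge form with respect to the end point
`(n + 1) h`. -/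
def gridBridge {E : Type*} [AddCommGroup E] [Module ℝ E] (n : ℕ) (h : ℝ≥0) (f : ℝ≥0 → E)
    (k : Fin n) : E :=
  ((n : ℝ) + 1) • f (((k : ℕ) + 1 : ℕ) * h) - (((k : ℕ) + 1 : ℕ) : ℝ) • f ((n + 1 : ℕ) * h)

/-- As a function of its second argument, `min a` is piecewise linear with its only kink at `a`, so
its second difference centred at `j + 1` vanishes unless `a = j + 1`. The kink at `n + 1` is never
seen because `j < n`. -/
theorem gridBridge_second_difference (k j n : ℕ) (hj : j < n) :
    ((n : ℝ) + 1) * ((min (k + 1) (j + 2) : ℕ) + (min (k + 1) j : ℕ) - 2 * (min (k + 1) (j + 1) : ℕ))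
      - (k + 1 : ℕ) * ((min (n + 1) (j + 2) : ℕ) + (min (n + 1) j : ℕ) -
        2 * (min (n + 1) (j + 1) : ℕ)) = if k = j then -((n : ℝ) + 1) else 0 := by
  have h1 : min (n + 1) (j + 2) = j + 2 := by omega
  have h2 : min (n + 1) j = j := by omega
  have h3 : min (n + 1) (j + 1) = j + 1 := by omega
  rw [h1, h2, h3]
  rcases lt_trichotomy k j with h | h | h
  · have e1 : min (k + 1) (j + 2) = k + 1 := by omega
    have e2 : min (k + 1) j = k + 1 := by omega
    have e3 : min (k + 1) (j + 1) = k + 1 := by omega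
    rw [e1, e2, e3, if_neg h.ne]; push_cast; ring
  · subst h
    have e1 : min (k + 1) (k + 2) = k + 1 := by omega
    have e2 : min (k + 1) k = k := by omega
    have e3 : min (k + 1) (k + 1) = k + 1 := by omega
    rw [e1, e2, e3, if_pos rfl]; push_cast; ring
  · have e1 : min (k + 1) (j + 2) = j + 2 := by omega
    have e2 : min (k + 1) j = j := by omega
    have e3 : min (k + 1) (j + 1) = j + 1 := by omega
    rw [e1, e2, e3, if_neg h.ne']; push_cast; ring

section Brownian

variable {Ω : Type*} [MeasurableSpace Ω] {P : Measure Ω} {B : ℝ≥0 → Ω → ℝ}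

theorem memLp_two_eval (hB : IsPreBrownianReal B P) (t : ℝ≥0) : MemLp (fun ω => B t ω) 2 P :=
  (hB.isGaussianProcess.hasGaussianLaw_eval t).memLp_two

theorem memLp_second_difference (hB : IsPreBrownianReal B P) (h : ℝ≥0) (j : ℕ) :
    MemLp (fun ω => B ((j + 2 : ℕ) * h) ω + B (j * h) ω - 2 * B ((j + 1 : ℕ) * h) ω) 2 P :=
  ((memLp_two_eval hB _).add (memLp_two_eval hB _)).sub ((memLp_two_eval hB _).const_mul _)

theorem memLp_gridBridge (hB : IsPreBrownianReal B P) (n : ℕ) (h : ℝ≥0) (k : Fin n) :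
    MemLp (fun ω => gridBridge n h (fun t => B t ω) k) 2 P :=
  ((memLp_two_eval hB _).const_mul _).sub ((memLp_two_eval hB _).const_mul _)

/-- Second differences of the path form a system biorthogonal to the grid bridge values, up to a
common factor. This exhibits nondegeneracy without inverting a covariance matrix. -/
theorem covariance_gridBridge (hB : IsPreBrownianReal B P) (n : ℕ) (h : ℝ≥0) (k j : Fin n) :
    cov[fun ω => gridBridge n h (fun t => B t ω) k,
      fun ω => B (((j : ℕ) + 2 : ℕ) * h) ω + B ((j : ℕ) * h) ω - 2 * B (((j : ℕ) + 1 : ℕ) * h) ω; P]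
      = if k = j then -(((n : ℝ) + 1) * h) else 0 := by
  have : IsProbabilityMeasure P := hB.isGaussianProcess.isProbabilityMeasure
  have hm := memLp_two_eval hB
  have hadd : MemLp (fun ω => B (((j : ℕ) + 2 : ℕ) * h) ω + B ((j : ℕ) * h) ω) 2 P :=
    (hm _).add (hm _)
  have hcov : ∀ a b : ℕ, cov[fun ω => B (a * h) ω, fun ω => B (b * h) ω; P]
      = ((min a b : ℕ) : ℝ) * h := fun a b => by
    rw [hB.covariance_fun_eval, ← NNReal.coe_natCast (min a b), ← NNReal.coe_mul, Nat.cast_min,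
      (monotone_mul_right_of_nonneg (zero_le : 0 ≤ h)).map_min]
  have hD : ∀ a : ℕ, cov[fun ω => B (a * h) ω,
      fun ω => B (((j : ℕ) + 2 : ℕ) * h) ω + B ((j : ℕ) * h) ω - 2 * B (((j : ℕ) + 1 : ℕ) * h) ω; P]
      = ((min a (j + 2) : ℕ) + (min a j : ℕ) - 2 * (min a (j + 1) : ℕ)) * h := fun a => by
    have hsum := covariance_add_right (hm (a * h)) (hm (((j : ℕ) + 2 : ℕ) * h)) (hm ((j : ℕ) * h))
    rw [covariance_fun_sub_right (hm _) hadd ((hm _).const_mul _), covariance_const_mul_right]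
    refine (congrArg (· - _) hsum).trans ?_
    rw [hcov, hcov, hcov]
    ring
  simp only [gridBridge, smul_eq_mul]
  rw [covariance_fun_sub_left ((hm _).const_mul _) ((hm _).const_mul _)
    (memLp_second_difference hB h j), covariance_const_mul_left,
    covariance_const_mul_left, hD, hD]
  have := gridBridge_second_difference k j n j.2
  rw [← mul_assoc, ← mul_assoc, ← sub_mul, this, ite_mul]
  simp only [Fin.ext_iff, zero_mul, neg_mul]

/-- The combination is Gaussian, and its covariance with the `j`-th second difference is a nonzero
multiple of `a j`. Choosing `a j ≠ 0` gives positive variance, and a Gaussian law with positive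
variance has no atoms. -/
theorem measure_gridBridge_combination_eq_zero (hB : IsPreBrownianReal B P) (n : ℕ) {h : ℝ≥0}
    (hh : 0 < h) (a : Fin n → ℝ) (ha : a ≠ 0) :
    P {ω | ∑ k, a k * gridBridge n h (fun t => B t ω) k = 0} = 0 := by
  classical
  have : IsProbabilityMeasure P := hB.isGaussianProcess.isProbabilityMeasure
  obtain ⟨j, hj⟩ := Function.ne_iff.1 ha
  set X : Ω → ℝ := fun ω => ∑ k, a k * gridBridge n h (fun t => B t ω) k with hX
  have hXm : MemLp X 2 P := memLp_finsetSum _ fun k _ => (memLp_gridBridge hB n h k).const_mul _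
  have hcov : cov[X, fun ω => B (((j : ℕ) + 2 : ℕ) * h) ω + B ((j : ℕ) * h) ω -
      2 * B (((j : ℕ) + 1 : ℕ) * h) ω; P] = -(a j * (((n : ℝ) + 1) * h)) := by
    rw [hX, covariance_fun_sum_left (fun k => (memLp_gridBridge hB n h k).const_mul _)
      (memLp_second_difference hB h j)]
    simp_rw [covariance_const_mul_left, covariance_gridBridge hB]
    simp
  have hvar : Var[X; P] ≠ 0 := by
    intro h0
    have h1 := ae_eq_integral_of_variance_eq_zero hXm h0
    have h2 : cov[X, fun ω => B (((j : ℕ) + 2 : ℕ) * h) ω + B ((j : ℕ) * h) ω -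
      2 * B (((j : ℕ) + 1 : ℕ) * h) ω; P] = 0 := by
      refine integral_eq_zero_of_ae ?_
      filter_upwards [h1] with ω hω
      simp [hω]
    rw [h2] at hcov
    have h3 : a j * (((n : ℝ) + 1) * h) ≠ 0 := by
      have : (0 : ℝ) < h := hh
      exact mul_ne_zero hj (by positivity)
    exact h3 (by linarith)
  have hG : HasGaussianLaw X P := by
    set I : Finset ℝ≥0 := insert (((n + 1 : ℕ) : ℝ≥0) * h)
      (Finset.univ.image fun k : Fin n => (((k : ℕ) + 1 : ℕ) : ℝ≥0) * h) with hI
    have hk : ∀ k : Fin n, (((k : ℕ) + 1 : ℕ) : ℝ≥0) * h ∈ I := fun k =>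
      Finset.mem_insert_of_mem (Finset.mem_image_of_mem _ (Finset.mem_univ k))
    have hn : (((n + 1 : ℕ) : ℝ≥0) * h) ∈ I := Finset.mem_insert_self _ _
    let L : (I → ℝ) →L[ℝ] ℝ := ∑ k, a k • (((n : ℝ) + 1) •
      ContinuousLinearMap.proj (R := ℝ) (φ := fun _ : I => ℝ) ⟨_, hk k⟩ - (((k : ℕ) + 1 : ℕ) : ℝ) •
      ContinuousLinearMap.proj (R := ℝ) (φ := fun _ : I => ℝ) ⟨_, hn⟩)
    have := (hB.isGaussianProcess.hasGaussianLaw I).map_fun L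
    have hXL : X = fun ω => L (I.restrict fun t => B t ω) := by
      ext ω
      simp [L, hX, gridBridge, _root_.sum_apply]
    rwa [hXL]
  have hmap := hG.map_eq_gaussianReal
  have hv : (Var[X; P]).toNNReal ≠ 0 := by
    rw [Ne, Real.toNNReal_eq_zero, not_le]
    exact lt_of_le_of_ne (variance_nonneg _ _) hvar.symm
  have := nullSingletonClass_gaussianReal (μ := P[X]) hv
  have h0 : P.map X {0} = 0 := by rw [hmap]; exact measure_singleton _
  rwa [Measure.map_apply_of_aemeasurable hXm.aemeasurable (measurableSet_singleton _)] at h0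

/-- The values of a vector Brownian motion, in bridge form, at as many grid points as there are
coordinates are almost surely linearly independent. -/
theorem ae_linearIndependent_gridBridge {p : ℕ} [IsProbabilityMeasure P]
    {W : ℝ≥0 → Ω → EuclideanSpace ℝ (Fin p)} (hW : IsBrownianVec W P) {h : ℝ≥0} (hh : 0 < h) :
    ∀ᵐ ω ∂P, LinearIndependent ℝ (gridBridge p h fun t => W t ω) := by
  set ξ : Fin p → Ω → Fin p → ℝ := fun i ω => gridBridge p h fun t => W t ω i with hξ
  have hmeas : ∀ i, AEMeasurable (ξ i) P := fun i =>
    aemeasurable_pi_iff.2 fun k => (memLp_gridBridge (hW.coord i).toIsPreBrownianReal p h k).aemeasurable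
  have hind : iIndepFun ξ P := by
    refine hW.indep.comp (fun _ f => gridBridge p h f) fun _ => ?_
    refine measurable_pi_iff.2 fun k => ?_
    simp only [gridBridge]
    fun_prop
  have hlaw := (iIndepFun_iff_map_fun_eq_pi_map hmeas).1 hind
  have hprob : ∀ i, IsProbabilityMeasure (P.map (ξ i)) := fun i =>
    Measure.isProbabilityMeasure_map (hmeas i)
  have hrow := ae_linearIndependent_pi (fun i => P.map (ξ i)) (fun i S hS => by
    -- A proper subspace lies in the kernel of a nonzero functional, whose value at the grid vector
    -- is a nontrivial combination of bridge values.
    obtain ⟨φ, hφ, hker⟩ := S.exists_le_ker_of_lt_top (lt_top_iff_ne_top.2 hS)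
    refine measure_mono_null (show (S : Set (Fin p → ℝ)) ⊆ {x | φ x = 0} from
      fun x hx => hker hx) ?_
    have hφm : Measurable φ := φ.continuous_of_finiteDimensional.measurable
    have hset : MeasurableSet {x | φ x = 0} := hφm (measurableSet_singleton 0)
    rw [Measure.map_apply_of_aemeasurable (hmeas i) hset]
    have hval : ∀ x, φ x = ∑ k, φ (Pi.single k 1) * x k := fun x => by
      rw [LinearMap.pi_apply_eq_sum_univ φ x]
      refine Finset.sum_congr rfl fun k _ => ?_
      rw [smul_eq_mul, mul_comm]
      congr 2
      ext l
      simp [Pi.single_apply, eq_comm]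
    convert measure_gridBridge_combination_eq_zero (hW.coord i).toIsPreBrownianReal p hh
      (fun k => φ (Pi.single k 1)) ?_ using 2
    · ext ω
      exact Eq.congr_left (hval (ξ i ω))
    · intro h0
      refine hφ (LinearMap.ext fun x => ?_)
      rw [hval]
      simp [fun k => congrFun h0 k]) (by simp)
  rw [← hlaw] at hrow
  have hrow' := ae_of_ae_map (aemeasurable_pi_iff.2 hmeas) hrow
  filter_upwards [hrow'] with ω hω
  -- Rows are the independent coordinates and columns are the grid points. With `p` grid points the
  -- matrix is square, so independence of the rows yields that of the columns.
  have hunit : IsUnit (Matrix.of fun i => ξ i ω) :=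
    Matrix.linearIndependent_rows_iff_isUnit.1 hω
  have hcol := Matrix.linearIndependent_cols_iff_isUnit.2 hunit
  refine LinearIndependent.of_comp
    (WithLp.linearEquiv 2 ℝ (Fin p → ℝ)).toLinearMap ?_
  have heq : (WithLp.linearEquiv 2 ℝ (Fin p → ℝ)).toLinearMap ∘ (gridBridge p h fun t => W t ω) =
      (Matrix.of fun i => ξ i ω).col := by
    ext k i
    simp [hξ, gridBridge]
  rwa [heq]

end Brownian

end SeqChange
namespace SeqChange

/-! ### Quadratic forms -/

theorem dotProduct_sum_vecMulVec_mulVec {ι : Type*} {p : ℕ} (s : Finset ι) (v : ι → Fin p → ℝ)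
    (y : Fin p → ℝ) :
    y ⬝ᵥ (∑ i ∈ s, vecMulVec (v i) (v i)) *ᵥ y = ∑ i ∈ s, (v i ⬝ᵥ y) ^ 2 := by
  rw [Matrix.sum_mulVec, dotProduct_sum]
  refine Finset.sum_congr rfl fun i _ => ?_
  rw [vecMulVec_mulVec, dotProduct_smul, dotProduct_comm y]
  simp [sq]

/-- Expand the nonnegative quadratic form of `V` at `V⁻¹ v - τ⁻¹ v`. Only the value of the form at
`v` itself has to be controlled; no spectral argument is needed. -/
theorem div_le_dotProduct_inv_mulVec {p : ℕ} {V : Matrix (Fin p) (Fin p) ℝ} (hV : V.PosDef)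
    {τ : ℝ} (hτ : 0 < τ) (v : Fin p → ℝ) (h : v ⬝ᵥ V *ᵥ v ≤ τ * (v ⬝ᵥ v)) :
    v ⬝ᵥ v / τ ≤ v ⬝ᵥ V⁻¹ *ᵥ v := by
  set y := V⁻¹ *ᵥ v with hy
  have hVy : V *ᵥ y = v := by
    rw [hy, mulVec_mulVec, mul_nonsing_inv _ ((Matrix.isUnit_iff_isUnit_det _).1 hV.isUnit),
      one_mulVec]
  have hsymm : y ⬝ᵥ V *ᵥ v = v ⬝ᵥ v := by
    have ht : Vᵀ = V := by simpa using hV.isHermitian.eq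
    rw [dotProduct_mulVec, ← mulVec_transpose, ht, hVy]
  have h0 : 0 ≤ (y - τ⁻¹ • v) ⬝ᵥ V *ᵥ (y - τ⁻¹ • v) := by
    simpa using hV.posSemidef.dotProduct_mulVec_nonneg (y - τ⁻¹ • v)
  simp only [mulVec_sub, mulVec_smul, hVy, sub_dotProduct, dotProduct_sub, smul_dotProduct,
    dotProduct_smul, hsymm, smul_eq_mul] at h0
  rw [dotProduct_comm y v] at h0
  have h1 : τ⁻¹ * (τ⁻¹ * (v ⬝ᵥ V *ᵥ v)) ≤ τ⁻¹ * (v ⬝ᵥ v) := by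
    gcongr
    rw [inv_mul_le_iff₀ hτ]
    exact h
  rw [div_eq_inv_mul]
  linarith

theorem dotProduct_ofLp_self {p : ℕ} (v : EuclideanSpace ℝ (Fin p)) :
    v.ofLp ⬝ᵥ v.ofLp = ‖v‖ ^ 2 := by
  rw [EuclideanSpace.real_norm_sq_eq]
  simp [dotProduct, sq]

theorem sq_dotProduct_le {p : ℕ} (v : EuclideanSpace ℝ (Fin p)) (y : Fin p → ℝ) :
    (v.ofLp ⬝ᵥ y) ^ 2 ≤ ‖v‖ ^ 2 * (y ⬝ᵥ y) := by
  have := Finset.sum_mul_sq_le_sq_mul_sq Finset.univ v.ofLp y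
  rw [EuclideanSpace.real_norm_sq_eq]
  simpa [dotProduct, sq] using this

/-! ### The self-normalizer on a block of observations -/

variable {d p : ℕ} (θ : ((Fin d → ℝ) → ℝ) → EuclideanSpace ℝ (Fin p))

/-- The weighted difference of the estimators from `x (l + 1), …, x j` and `x (j + 1), …, x b`. -/
noncomputable def blockVec (x : ℕ → Fin d → ℝ) (l b j : ℕ) : EuclideanSpace ℝ (Fin p) :=
  (((j : ℝ) - l) * ((b : ℝ) - j)) • (estimator θ x (l + 1) j - estimator θ x (j + 1) b)

theorem selfNormalizer_eq (x : ℕ → Fin d → ℝ) (z u : ℕ) :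
    selfNormalizer θ x z u =
      ∑ j ∈ Finset.Icc 1 z, vecMulVec (blockVec θ x 0 z j).ofLp (blockVec θ x 0 z j).ofLp +
      ∑ j ∈ Finset.Icc (z + 1) u,
        vecMulVec (blockVec θ x z u j).ofLp (blockVec θ x z u j).ofLp := by
  simp only [selfNormalizer, blockVec, estimatorDiff, WithLp.ofLp_smul, smul_vecMulVec,
    vecMulVec_smul, smul_smul]
  congr 1 <;> refine Finset.sum_congr rfl fun j _ => ?_ <;> congr 1 <;> push_cast <;> ring

theorem dotProduct_selfNormalizer_mulVec (x : ℕ → Fin d → ℝ) (z u : ℕ) (y : Fin p → ℝ) :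
    y ⬝ᵥ selfNormalizer θ x z u *ᵥ y =
      ∑ j ∈ Finset.Icc 1 z, ((blockVec θ x 0 z j).ofLp ⬝ᵥ y) ^ 2 +
      ∑ j ∈ Finset.Icc (z + 1) u, ((blockVec θ x z u j).ofLp ⬝ᵥ y) ^ 2 := by
  rw [selfNormalizer_eq, add_mulVec, dotProduct_add, dotProduct_sum_vecMulVec_mulVec,
    dotProduct_sum_vecMulVec_mulVec]

theorem dotProduct_selfNormalizer_mulVec_le {x : ℕ → Fin d → ℝ} {z u : ℕ} (hzu : z ≤ u) {M : ℝ}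
    (h₁ : ∀ j ∈ Finset.Icc 1 z, ‖blockVec θ x 0 z j‖ ≤ M)
    (h₂ : ∀ j ∈ Finset.Icc (z + 1) u, ‖blockVec θ x z u j‖ ≤ M) (y : Fin p → ℝ) :
    y ⬝ᵥ selfNormalizer θ x z u *ᵥ y ≤ u * M ^ 2 * (y ⬝ᵥ y) := by
  have hy : 0 ≤ y ⬝ᵥ y := Finset.sum_nonneg fun _ _ => mul_self_nonneg _
  have key : ∀ v : EuclideanSpace ℝ (Fin p), ‖v‖ ≤ M → (v.ofLp ⬝ᵥ y) ^ 2 ≤ M ^ 2 * (y ⬝ᵥ y) :=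
    fun v hv => (sq_dotProduct_le v y).trans (by gcongr)
  rw [dotProduct_selfNormalizer_mulVec]
  refine (add_le_add (Finset.sum_le_card_nsmul _ _ _ fun j hj => key _ (h₁ j hj))
    (Finset.sum_le_card_nsmul _ _ _ fun j hj => key _ (h₂ j hj))).trans (le_of_eq ?_)
  rw [← add_smul, Nat.card_Icc, Nat.card_Icc, nsmul_eq_mul, mul_assoc]
  congr 2
  omega

/-- A vector on which the quadratic form vanishes is orthogonal to every summand of the first sum,
hence to a basis, hence to itself. -/
theorem posDef_selfNormalizer {x : ℕ → Fin d → ℝ} {z u : ℕ} (J : Fin p → ℕ)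
    (hJ : ∀ k, J k ∈ Finset.Icc 1 z)
    (hli : LinearIndependent ℝ fun k => blockVec θ x 0 z (J k)) :
    (selfNormalizer θ x z u).PosDef := by
  refine Matrix.PosDef.of_dotProduct_mulVec_pos ?_ fun y hy => ?_
  · ext i j
    simp [selfNormalizer_eq, Matrix.sum_apply, vecMulVec_apply, mul_comm]
  · rw [star_trivial, dotProduct_selfNormalizer_mulVec]
    refine add_pos_of_pos_of_nonneg ?_ (Finset.sum_nonneg fun _ _ => sq_nonneg _)
    refine (Finset.sum_nonneg fun _ _ => sq_nonneg _).lt_of_ne fun h0 => hy ?_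
    have h1 := (Finset.sum_eq_zero_iff_of_nonneg fun _ _ => sq_nonneg _).1 h0.symm
    have hspan := hli.span_eq_top_of_card_eq_finrank' (by simp)
    have h2 : ∀ v : EuclideanSpace ℝ (Fin p), v.ofLp ⬝ᵥ y = 0 := fun v => by
      have hv : v ∈ Submodule.span ℝ (Set.range fun k => blockVec θ x 0 z (J k)) := by
        rw [hspan]; trivial
      induction hv using Submodule.span_induction with
      | mem v hv =>
        obtain ⟨k, rfl⟩ := hv
        exact pow_eq_zero_iff two_ne_zero |>.1 (h1 _ (hJ k))
      | zero => simp
      | add v w _ _ hv hw => simp [add_dotProduct, hv, hw]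
      | smul a v _ hv => simp [smul_dotProduct, hv]
    exact dotProduct_self_eq_zero.1 (h2 (WithLp.toLp 2 y))

/-- Keep only the candidate `j = z - m` of the maximum. The normalizer has `m + k` rank-one terms of
size at most `M²`, which gives `τ = (m + k) M²` in `div_le_dotProduct_inv_mulVec`. -/
theorem le_detectorSN {x : ℕ → Fin d → ℝ} {m k z : ℕ} (hmz : m ≤ z) (hzk : z < m + k) {M δ : ℝ}
    (hM : 0 < M) (hδ : 0 ≤ δ) (J : Fin p → ℕ) (hJ : ∀ i, J i ∈ Finset.Icc 1 z)
    (hli : LinearIndependent ℝ fun i => blockVec θ x 0 z (J i))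
    (h₁ : ∀ j ∈ Finset.Icc 1 z, ‖blockVec θ x 0 z j‖ ≤ M)
    (h₂ : ∀ j ∈ Finset.Icc (z + 1) (m + k), ‖blockVec θ x z (m + k) j‖ ≤ M)
    (hdiff : δ ≤ ‖estimator θ x 1 z - estimator θ x (z + 1) (m + k)‖) :
    (m : ℝ) * ((z : ℝ) ^ 2 * ((m + k : ℕ) - (z : ℝ)) ^ 2 * (δ ^ 2 / ((m + k : ℕ) * M ^ 2))) ≤
      detectorSN θ x m k := by
  obtain ⟨j, rfl⟩ := Nat.exists_eq_add_of_le hmz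
  have hjk : j < k := by omega
  refine mul_le_mul_of_nonneg_left ?_ (Nat.cast_nonneg _)
  refine le_trans ?_ (le_ciSup (f := fun j : Fin k => ((m : ℝ) + (j : ℕ)) ^ 2 *
    ((k : ℝ) - (j : ℕ)) ^ 2 * (estimatorDiff θ x 0 (m + j) (m + k) ⬝ᵥ
      (selfNormalizer θ x (m + j) (m + k))⁻¹ *ᵥ estimatorDiff θ x 0 (m + j) (m + k)))
    (Set.finite_range _).bddAbove ⟨j, hjk⟩)
  have hu : (0 : ℝ) < (m + k : ℕ) := by exact_mod_cast (by omega : 0 < m + k)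
  have hτ : 0 < (m + k : ℕ) * M ^ 2 := by positivity
  have hpd : (selfNormalizer θ x (m + j) (m + k)).PosDef := posDef_selfNormalizer θ J hJ hli
  have := div_le_dotProduct_inv_mulVec hpd hτ (estimatorDiff θ x 0 (m + j) (m + k))
    (dotProduct_selfNormalizer_mulVec_le θ hzk.le h₁ h₂ _)
  have hle : δ ^ 2 ≤ estimatorDiff θ x 0 (m + j) (m + k) ⬝ᵥ
      estimatorDiff θ x 0 (m + j) (m + k) := by
    rw [estimatorDiff, dotProduct_ofLp_self]
    simp only [zero_add]
    gcongr
  have hk : ((m + k : ℕ) : ℝ) - (m + j : ℕ) = k - j := by push_cast; ring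
  rw [hk, Nat.cast_add m j]
  refine mul_le_mul_of_nonneg_left (le_trans ?_ this) (by positivity)
  gcongr

theorem le_maxDetectorSN (x : ℕ → Fin d → ℝ) (w : ℝ → ℝ) (T : ℝ) {m k : ℕ} (hk : 0 < k)
    (hkT : k ≤ ⌊(m : ℝ) * T⌋₊) :
    detectorSN θ x m k / w (k / m) ≤ maxDetectorSN θ w T x m := by
  have := le_ciSup (f := fun i : Fin ⌊(m : ℝ) * T⌋₊ =>
    detectorSN θ x m ((i : ℕ) + 1) / w ((((i : ℕ) + 1 : ℕ) : ℝ) / m))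
    (Set.finite_range _).bddAbove ⟨k - 1, by omega⟩
  simp only [Nat.sub_add_cancel hk] at this
  exact this

/-! ### Linearization on a block -/

/-- The remainders of the linearization over the stretches of the block `(l, b]` that share an
end point with it are at most `ρ`. -/
def EdgeBound (F : (Fin d → ℝ) → ℝ) (x : ℕ → Fin d → ℝ) (l b : ℕ) (ρ : ℝ) : Prop :=
  ∀ i j, l < i → i ≤ j → j ≤ b → (i = l + 1 ∨ j = b) →
    ((j : ℝ) - i + 1) * ‖remainder θ F x i j‖ ≤ ρ

variable {θ}

theorem estimator_eq (F : (Fin d → ℝ) → ℝ) (x : ℕ → Fin d → ℝ) {l b : ℕ} :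
    estimator θ x (l + 1) b = θ F + ((b : ℝ) - l)⁻¹ • ∑ t ∈ Finset.Ioc l b, influence θ F (x t) +
      remainder θ F x (l + 1) b := by
  have h : (b : ℝ) - (l + 1 : ℕ) + 1 = b - l := by push_cast; ring
  rw [remainder, h, ← Finset.Icc_add_one_left_eq_Ioc]
  abel

/-- Within one regime `θ F` cancels, and the weight `(j - l)(b - j)` clears both averaging
denominators, leaving a discrete bridge of the influence sums plus remainders. -/
theorem blockVec_eq (F : (Fin d → ℝ) → ℝ) (x : ℕ → Fin d → ℝ) {l b j : ℕ} (hlj : l ≤ j)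
    (hjb : j ≤ b) :
    blockVec θ x l b j = ((b : ℝ) - l) • ∑ t ∈ Finset.Ioc l j, influence θ F (x t) -
      ((j : ℝ) - l) • ∑ t ∈ Finset.Ioc l b, influence θ F (x t) +
      (((j : ℝ) - l) * ((b : ℝ) - j)) •
        (remainder θ F x (l + 1) j - remainder θ F x (j + 1) b) := by
  -- At `j = l` or `j = b` one estimator is computed from an empty stretch, but the weight vanishes
  -- and so does the bridge.
  rcases hlj.eq_or_lt with rfl | hlj
  · simp [blockVec]
  rcases hjb.eq_or_lt with rfl | hjb
  · simp [blockVec]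
  have h₁ : (j : ℝ) - l ≠ 0 := sub_ne_zero.2 (by exact_mod_cast hlj.ne')
  have h₂ : (b : ℝ) - j ≠ 0 := sub_ne_zero.2 (by exact_mod_cast hjb.ne')
  rw [blockVec, estimator_eq F x, estimator_eq F x,
    ← Finset.sum_Ioc_consecutive (fun t => influence θ F (x t)) hlj.le hjb.le]
  match_scalars <;> field_simp <;> ring

theorem norm_blockVec_sub_le {F : (Fin d → ℝ) → ℝ} {x : ℕ → Fin d → ℝ} {l b j : ℕ} {ρ : ℝ}
    (hρ : 0 ≤ ρ) (hE : EdgeBound θ F x l b ρ) (hlj : l ≤ j) (hjb : j ≤ b) :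
    ‖blockVec θ x l b j - (((b : ℝ) - l) • ∑ t ∈ Finset.Ioc l j, influence θ F (x t) -
      ((j : ℝ) - l) • ∑ t ∈ Finset.Ioc l b, influence θ F (x t))‖ ≤ 2 * (((b : ℝ) - l) * ρ) := by
  rw [blockVec_eq F x hlj hjb, add_sub_cancel_left]
  have hlj' : (0 : ℝ) ≤ (j : ℝ) - l := sub_nonneg.2 (by exact_mod_cast hlj)
  have hjb' : (0 : ℝ) ≤ (b : ℝ) - j := sub_nonneg.2 (by exact_mod_cast hjb)
  rcases hlj.eq_or_lt with rfl | hlj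
  · simpa using by positivity
  rcases hjb.eq_or_lt with rfl | hjb
  · simpa using by positivity
  have h₁ := hE (l + 1) j (by omega) hlj hjb.le (Or.inl rfl)
  have h₂ := hE (j + 1) b (by omega) hjb le_rfl (Or.inr rfl)
  have e₁ : (j : ℝ) - (l + 1 : ℕ) + 1 = j - l := by push_cast; ring
  have e₂ : (b : ℝ) - (j + 1 : ℕ) + 1 = b - j := by push_cast; ring
  rw [e₁] at h₁
  rw [e₂] at h₂
  rw [norm_smul, Real.norm_of_nonneg (by positivity)]
  calc ((j : ℝ) - l) * ((b : ℝ) - j) * ‖remainder θ F x (l + 1) j - remainder θ F x (j + 1) b‖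
      ≤ ((j : ℝ) - l) * ((b : ℝ) - j) *
        (‖remainder θ F x (l + 1) j‖ + ‖remainder θ F x (j + 1) b‖) := by
        gcongr; exact norm_sub_le _ _
    _ = ((b : ℝ) - j) * (((j : ℝ) - l) * ‖remainder θ F x (l + 1) j‖) +
        ((j : ℝ) - l) * (((b : ℝ) - j) * ‖remainder θ F x (j + 1) b‖) := by ring
    _ ≤ ((b : ℝ) - j) * ρ + ((j : ℝ) - l) * ρ := by gcongr
    _ = ((b : ℝ) - l) * ρ := by ring
    _ ≤ 2 * (((b : ℝ) - l) * ρ) := by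
        have : 0 ≤ ((b : ℝ) - l) * ρ := mul_nonneg (by linarith) hρ
        linarith

theorem norm_blockVec_le {F : (Fin d → ℝ) → ℝ} {x : ℕ → Fin d → ℝ} {l b j : ℕ} {ρ K : ℝ}
    (hρ : 0 ≤ ρ) (hE : EdgeBound θ F x l b ρ) (hlj : l ≤ j) (hjb : j ≤ b)
    (hS : ∀ i, l ≤ i → i ≤ b → ‖∑ t ∈ Finset.Ioc l i, influence θ F (x t)‖ ≤ K) :
    ‖blockVec θ x l b j‖ ≤ 2 * (((b : ℝ) - l) * (K + ρ)) := by
  have h := norm_blockVec_sub_le hρ hE hlj hjb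
  have hlj' : (0 : ℝ) ≤ (j : ℝ) - l := sub_nonneg.2 (by exact_mod_cast hlj)
  have hjb' : (0 : ℝ) ≤ (b : ℝ) - j := sub_nonneg.2 (by exact_mod_cast hjb)
  have hK : 0 ≤ K := (norm_nonneg _).trans (hS j hlj hjb)
  have h2 : ‖((b : ℝ) - l) • ∑ t ∈ Finset.Ioc l j, influence θ F (x t) -
      ((j : ℝ) - l) • ∑ t ∈ Finset.Ioc l b, influence θ F (x t)‖ ≤ 2 * (((b : ℝ) - l) * K) := by
    refine (norm_sub_le _ _).trans ?_
    rw [norm_smul, norm_smul, Real.norm_of_nonneg hlj', Real.norm_of_nonneg (by linarith)]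
    have e₁ := mul_le_mul_of_nonneg_left (hS j hlj hjb) (by linarith : 0 ≤ (b : ℝ) - l)
    have e₂ := mul_le_mul_of_nonneg_left (hS b (hlj.trans hjb) le_rfl) hlj'
    nlinarith
  have h3 := norm_add_le (blockVec θ x l b j - (((b : ℝ) - l) •
    ∑ t ∈ Finset.Ioc l j, influence θ F (x t) - ((j : ℝ) - l) •
    ∑ t ∈ Finset.Ioc l b, influence θ F (x t))) (((b : ℝ) - l) •
    ∑ t ∈ Finset.Ioc l j, influence θ F (x t) - ((j : ℝ) - l) •
    ∑ t ∈ Finset.Ioc l b, influence θ F (x t))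
  rw [sub_add_cancel] at h3
  linarith

theorem norm_estimator_sub_le {F : (Fin d → ℝ) → ℝ} {x : ℕ → Fin d → ℝ} {l b : ℕ} {ρ K : ℝ}
    (hE : EdgeBound θ F x l b ρ) (hlb : l < b)
    (hS : ‖∑ t ∈ Finset.Ioc l b, influence θ F (x t)‖ ≤ K) :
    ‖estimator θ x (l + 1) b - θ F‖ ≤ (K + ρ) / ((b : ℝ) - l) := by
  have hlb' : (0 : ℝ) < (b : ℝ) - l := sub_pos.2 (by exact_mod_cast hlb)
  have h₁ := hE (l + 1) b (by omega) hlb le_rfl (Or.inl rfl)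
  have e₁ : (b : ℝ) - (l + 1 : ℕ) + 1 = b - l := by push_cast; ring
  rw [e₁] at h₁
  rw [estimator_eq F x, add_assoc, add_sub_cancel_left, le_div_iff₀ hlb']
  calc _ ≤ (‖((b : ℝ) - l)⁻¹ • ∑ t ∈ Finset.Ioc l b, influence θ F (x t)‖ +
        ‖remainder θ F x (l + 1) b‖) * ((b : ℝ) - l) := by gcongr; exact norm_add_le _ _
    _ = ‖∑ t ∈ Finset.Ioc l b, influence θ F (x t)‖ +
        ((b : ℝ) - l) * ‖remainder θ F x (l + 1) b‖ := by
        rw [norm_smul, norm_inv, Real.norm_of_nonneg hlb'.le]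
        field_simp
    _ ≤ K + ρ := by gcongr

end SeqChange
namespace SeqChange

/-! ### Consequences of weak convergence -/

section WeakConvergence

variable {S : Type*} [MetricSpace S] {Ω Ω' : Type*} [MeasurableSpace Ω] [MeasurableSpace Ω']
  {X : ℕ → Ω → S} {Y : Ω' → S} {P : Measure Ω} [IsProbabilityMeasure P] {P' : Measure Ω'}
  [IsProbabilityMeasure P']

theorem TendstoWeakly.eventually_measure_lt (h : TendstoWeakly X Y P P') {F : Set S}
    (hF : IsClosed F) {ε : ℝ≥0∞} (hlt : P' (Y ⁻¹' F) < ε) : ∀ᶠ n in atTop, P (X n ⁻¹' F) < ε := by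
  let _ : MeasurableSpace S := borel S
  have : BorelSpace S := ⟨rfl⟩
  have h' : TendstoInDistribution X atTop Y (fun _ => P) P' := h
  have h1 := ProbabilityMeasure.limsup_measure_closed_le_of_tendsto h'.tendsto hF
  simp only [ProbabilityMeasure.coe_mk] at h1
  rw [Measure.map_apply_of_aemeasurable h'.aemeasurable_limit hF.measurableSet] at h1
  filter_upwards [eventually_lt_of_limsup_lt (h1.trans_lt hlt)] with n hn
  rwa [Measure.map_apply_of_aemeasurable (h'.forall_aemeasurable n) hF.measurableSet] at hn

theorem TendstoWeakly.comp_continuous {S' : Type*} [MetricSpace S'] {f : S → S'}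
    (h : TendstoWeakly X Y P P') (hf : Continuous f) :
    TendstoWeakly (fun n ω => f (X n ω)) (fun ω => f (Y ω)) P P' := by
  let _ : MeasurableSpace S := borel S
  have : BorelSpace S := ⟨rfl⟩
  let _ : MeasurableSpace S' := borel S'
  have : BorelSpace S' := ⟨rfl⟩
  have h' : TendstoInDistribution X atTop Y (fun _ => P) P' := h
  exact h'.continuous_comp hf

theorem tendsto_measure_ge_zero {Ω : Type*} [MeasurableSpace Ω] {P : Measure Ω}
    [IsFiniteMeasure P] {f : Ω → ℝ} (hf : AEMeasurable f P) {K : ℕ → ℝ}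
    (hK : Tendsto K atTop atTop) : Tendsto (fun n => P {ω | K n ≤ f ω}) atTop (𝓝 0) := by
  have h0 : Tendsto (fun a : ℝ => P {ω | a ≤ f ω}) atTop (𝓝 0) := by
    have h1 := tendsto_measure_iInter_atTop (μ := P) (s := fun a : ℝ => {ω | a ≤ f ω})
      (fun a => nullMeasurableSet_le aemeasurable_const hf)
      (fun a b hab ω hω => le_trans hab hω) ⟨0, measure_ne_top _ _⟩
    have h2 : ⋂ a : ℝ, {ω | a ≤ f ω} = ∅ := by
      refine Set.eq_empty_of_forall_notMem fun ω hω => ?_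
      have := Set.mem_iInter.1 hω (f ω + 1)
      simp only [Set.mem_ofPred_eq] at this
      linarith
    rwa [h2, measure_empty] at h1
  exact h0.comp hK

theorem TendstoWeakly.exists_eventually_measure_ge_lt {X : ℕ → Ω → ℝ} {Y : Ω' → ℝ}
    (h : TendstoWeakly X Y P P') {ε : ℝ≥0∞} (hε : 0 < ε) :
    ∃ K : ℝ, 0 < K ∧ ∀ᶠ n in atTop, P {ω | K ≤ X n ω} < ε := by
  have hY : AEMeasurable Y P' := by
    have := TendstoInDistribution.aemeasurable_limit h
    rwa [← BorelSpace.measurable_eq (α := ℝ)] at this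
  have h1 := tendsto_measure_ge_zero hY tendsto_natCast_atTop_atTop
  obtain ⟨N, hN⟩ := ((h1.eventually (gt_mem_nhds hε)).and (eventually_gt_atTop 0)).exists
  exact ⟨N, by exact_mod_cast hN.2, h.eventually_measure_lt isClosed_Ici hN.1⟩

/-- If the limit lies in an open set almost surely, then with high probability the approximations
stay away from its complement. -/
theorem TendstoWeakly.exists_eventually_ball_subset [ProperSpace S]
    (h : TendstoWeakly X Y P P') {U : Set S} (hU : IsOpen U) (hYU : ∀ᵐ ω ∂P', Y ω ∈ U)
    {ε : ℝ≥0∞} (hε : 0 < ε) :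
    ∃ τ : ℝ, 0 < τ ∧ ∀ᶠ n in atTop, P {ω | ¬ Metric.ball (X n ω) τ ⊆ U} < ε := by
  let _ : MeasurableSpace S := borel S
  have : BorelSpace S := ⟨rfl⟩
  have hY : AEMeasurable Y P' := TendstoInDistribution.aemeasurable_limit h
  have hprob : IsProbabilityMeasure (P'.map Y) := Measure.isProbabilityMeasure_map hY
  -- A compact `C ⊆ U` carries almost all the limiting mass, and some `δ`-thickening of it stays in
  -- `U`. By the portmanteau theorem the approximations lie in the `δ/2`-thickening with high
  -- probability, which leaves a margin of `δ/2`.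
  obtain ⟨C, hCU, hC, hlt⟩ := hU.measurableSet.exists_isCompact_sdiff_lt
    (measure_ne_top (P'.map Y) U) hε.ne'
  obtain ⟨δ, hδ, hδU⟩ := hC.exists_thickening_subset_open hU hCU
  refine ⟨δ / 2, half_pos hδ, ?_⟩
  have hF : IsClosed (Metric.thickening (δ / 2) C)ᶜ := Metric.isOpen_thickening.isClosed_compl
  have hsmall : P' (Y ⁻¹' (Metric.thickening (δ / 2) C)ᶜ) < ε := by
    refine lt_of_le_of_lt ?_ hlt
    rw [Measure.map_apply_of_aemeasurable hY (hU.measurableSet.diff hC.measurableSet)]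
    refine measure_mono_ae ?_
    filter_upwards [hYU] with ω hω hω'
    exact ⟨hω, fun hc => hω' (Metric.self_subset_thickening (half_pos hδ) C hc)⟩
  filter_upwards [h.eventually_measure_lt hF hsmall] with n hn
  have hsub : {ω | ¬ Metric.ball (X n ω) (δ / 2) ⊆ U} ⊆
      X n ⁻¹' (Metric.thickening (δ / 2) C)ᶜ := by
    refine fun ω hω hmem => hω fun s hs => ?_
    obtain ⟨y, hy, hdist⟩ := Metric.mem_thickening_iff.1 hmem
    refine hδU (Metric.mem_thickening_iff.2 ⟨y, hy, ?_⟩)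
    have := dist_triangle s (X n ω) y
    rw [Metric.mem_ball] at hs
    linarith
  exact (measure_mono hsub).trans_lt hn

end WeakConvergence

/-! ### Evaluation in `ℓ^∞` -/

theorem continuous_eval_LInf {a b : ℝ} {p : ℕ} (s : Set.Icc a b) :
    Continuous fun y : LInf a b p => y s := by
  refine (LipschitzWith.of_dist_le_mul (K := 1) fun y y' => ?_).continuous
  rw [NNReal.coe_one, one_mul, dist_eq_norm, dist_eq_norm]
  exact lp.norm_apply_le_norm ENNReal.top_ne_zero (y - y') s

/-- The path at `s = i / m` is the sum up to `i`. The case `i = l` is separate: for `l = ⌊m a⌋` the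
point `l / m` may fall to the left of `a`, but then the sum is empty. -/
theorem norm_sum_Ioc_le {p : ℕ} {a b : ℝ} (g : ℕ → EuclideanSpace ℝ (Fin p)) {m l i : ℕ}
    (hm : 0 < m) (hli : i = l ∨ m * a ≤ i) (hib : (i : ℝ) ≤ m * b) :
    ‖∑ t ∈ Finset.Ioc l i, g t‖ ≤ ‖toLInf a b (partialSum g m l)‖ * √m := by
  rcases hli with rfl | hai
  · simpa using mul_nonneg (norm_nonneg _) (Real.sqrt_nonneg _)
  have hm' : (0 : ℝ) < m := by exact_mod_cast hm
  let s : Set.Icc a b := ⟨i / m, (le_div_iff₀' hm').2 hai, (div_le_iff₀' hm').2 hib⟩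
  have h1 := lp.norm_apply_le_norm ENNReal.top_ne_zero (toLInf a b (partialSum g m l)) s
  rw [toLInf_apply (memLInf_partialSum g m l)] at h1
  have hs : (m : ℝ) * (i / m) = i := by field_simp
  rw [partialSum, hs, Nat.floor_natCast, norm_smul, norm_inv,
    Real.norm_of_nonneg (Real.sqrt_nonneg _), inv_mul_le_iff₀ (Real.sqrt_pos.2 hm')] at h1
  linarith

/-! ### Transfer between equally distributed blocks -/

/-- An event determined by the block is unaffected when the sample is replaced by `0` outside it, so
it is a measurable event of the block vector. -/
theorem measure_mem_eq_of_block {E Ω Ω' : Type*} [MeasurableSpace E] [Zero E]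
    [MeasurableSpace Ω] [MeasurableSpace Ω'] {P : Measure Ω} {P' : Measure Ω'} {X : ℕ → Ω → E}
    {Y : ℕ → Ω' → E} {a b : ℕ}
    (h : IdentDistrib (fun ω (t : Finset.Icc a b) => X t ω) (fun ω (t : Finset.Icc a b) => Y t ω)
      P P') {S : Set (ℕ → E)} (hS : MeasurableSet S)
    (hdep : ∀ x y : ℕ → E, (∀ t ∈ Finset.Icc a b, x t = y t) → (x ∈ S ↔ y ∈ S)) :
    P {ω | (fun t => X t ω) ∈ S} = P' {ω | (fun t => Y t ω) ∈ S} := by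
  let e : (Finset.Icc a b → E) → ℕ → E := fun y t => if ht : t ∈ Finset.Icc a b then y ⟨t, ht⟩ else 0
  have he : Measurable e := by
    refine measurable_pi_iff.2 fun t => ?_
    by_cases ht : t ∈ Finset.Icc a b
    · simpa only [e, dif_pos ht] using measurable_pi_apply _
    · simpa only [e, dif_neg ht] using measurable_const
  have key := h.measure_mem_eq (he hS)
  have hext : ∀ x : ℕ → E, x ∈ S ↔ e (fun t => x t) ∈ S := fun x => by
    refine hdep _ _ fun t ht => ?_
    simp only [e, dif_pos ht]
  have h1 : {ω | (fun t => X t ω) ∈ S} = (fun ω (t : Finset.Icc a b) => X t ω) ⁻¹' (e ⁻¹' S) :=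
    Set.ext fun ω => hext _
  have h2 : {ω | (fun t => Y t ω) ∈ S} = (fun ω (t : Finset.Icc a b) => Y t ω) ⁻¹' (e ⁻¹' S) :=
    Set.ext fun ω => hext _
  rw [h1, h2, key]

variable {d p : ℕ} {θ : ((Fin d → ℝ) → ℝ) → EuclideanSpace ℝ (Fin p)}

theorem estimator_congr {x y : ℕ → Fin d → ℝ} {i j : ℕ} (h : ∀ t ∈ Finset.Icc i j, x t = y t) :
    estimator θ x i j = estimator θ y i j := by
  have : empDistFun x i j = empDistFun y i j := by
    ext z
    simp only [empDistFun]
    rw [Finset.sum_congr rfl fun t ht => by rw [h t ht]]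
  rw [estimator, estimator, this]

theorem blockVec_congr {x y : ℕ → Fin d → ℝ} {l b j : ℕ}
    (h : ∀ t ∈ Finset.Icc (l + 1) b, x t = y t) (hj : j ∈ Set.Icc l b) :
    blockVec θ x l b j = blockVec θ y l b j := by
  rw [blockVec, blockVec, estimator_congr fun t ht => h t ?_, estimator_congr fun t ht => h t ?_]
  · rw [Finset.mem_Icc] at ht ⊢
    exact ⟨ht.1.trans' (by have := hj.1; omega), ht.2⟩
  · rw [Finset.mem_Icc] at ht ⊢
    exact ⟨ht.1, ht.2.trans hj.2⟩

theorem measurable_blockVec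
    (hθ : ∀ i j : ℕ, Measurable fun x : ℕ → Fin d → ℝ => estimator θ x i j) (l b j : ℕ) :
    Measurable fun x => blockVec θ x l b j :=
  ((hθ (l + 1) j).sub (hθ (j + 1) b)).const_smul (((j : ℝ) - l) * ((b : ℝ) - j))

variable (θ) in
/-- The samples for which all weighted differences of estimators on the block `(l, b]` are bounded
by `M` and the estimator from the whole block is `δ`-close to `θ F`. -/
def blockGood (F : (Fin d → ℝ) → ℝ) (l b : ℕ) (M δ : ℝ) : Set (ℕ → Fin d → ℝ) :=
  {x | (∀ j ∈ Finset.Icc (l + 1) b, ‖blockVec θ x l b j‖ ≤ M) ∧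
    ‖estimator θ x (l + 1) b - θ F‖ ≤ δ}

theorem measurableSet_blockGood
    (hθ : ∀ i j : ℕ, Measurable fun x : ℕ → Fin d → ℝ => estimator θ x i j)
    (F : (Fin d → ℝ) → ℝ) (l b : ℕ) (M δ : ℝ) : MeasurableSet (blockGood θ F l b M δ) := by
  have hset : {x : ℕ → Fin d → ℝ | ∀ j ∈ Finset.Icc (l + 1) b, ‖blockVec θ x l b j‖ ≤ M} =
      ⋂ j ∈ Finset.Icc (l + 1) b, {x | ‖blockVec θ x l b j‖ ≤ M} := by ext; simp
  refine MeasurableSet.inter (s₁ := {x : ℕ → Fin d → ℝ |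
      ∀ j ∈ Finset.Icc (l + 1) b, ‖blockVec θ x l b j‖ ≤ M}) ?_
    (measurableSet_le ((hθ _ _).sub_const _).norm measurable_const)
  rw [hset]
  exact Finset.measurableSet_biInter _ fun j _ =>
    measurableSet_le (measurable_blockVec hθ l b j).norm measurable_const

theorem mem_blockGood_congr {F : (Fin d → ℝ) → ℝ} {l b : ℕ} {M δ : ℝ} {x y : ℕ → Fin d → ℝ}
    (h : ∀ t ∈ Finset.Icc (l + 1) b, x t = y t) :
    x ∈ blockGood θ F l b M δ ↔ y ∈ blockGood θ F l b M δ := by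
  refine and_congr (forall₂_congr fun j hj => ?_) (by rw [estimator_congr h])
  rw [Finset.mem_Icc] at hj
  rw [blockVec_congr h ⟨by omega, hj.2⟩]

theorem mem_blockGood {F : (Fin d → ℝ) → ℝ} {x : ℕ → Fin d → ℝ} {l b m : ℕ} {K U δ : ℝ}
    (hK : 0 ≤ K) (hE : EdgeBound θ F x l b √m) (hlb : l < b) (hU : (b : ℝ) - l ≤ U * m)
    (hS : ∀ i, l ≤ i → i ≤ b → ‖∑ t ∈ Finset.Ioc l i, influence θ F (x t)‖ ≤ K * √m)
    (hδ : (K + 1) * √m ≤ δ * ((b : ℝ) - l)) :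
    x ∈ blockGood θ F l b (2 * U * (K + 1) * (m * √m)) δ := by
  have hlb' : (0 : ℝ) < (b : ℝ) - l := sub_pos.2 (by exact_mod_cast hlb)
  refine ⟨fun j hj => ?_, ?_⟩
  · rw [Finset.mem_Icc] at hj
    refine (norm_blockVec_le (Real.sqrt_nonneg _) hE (by omega) hj.2 hS).trans ?_
    calc 2 * (((b : ℝ) - l) * (K * √m + √m)) ≤ 2 * ((U * m) * (K * √m + √m)) := by gcongr
      _ = _ := by ring
  · refine (norm_estimator_sub_le hE hlb (hS b hlb.le le_rfl)).trans ?_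
    rw [div_le_iff₀ hlb']
    linarith

/-! ### Remainders along a regime -/

section Regime

variable {Ω : Type*} [MeasurableSpace Ω] {P : Measure Ω} [IsProbabilityMeasure P]
  {F : (Fin d → ℝ) → ℝ} {Sig : Matrix (Fin p) (Fin p) ℝ} {Z : ℤ → Ω → Fin d → ℝ}

theorem remainder_self (x : ℕ → Fin d → ℝ) (i : ℕ) :
    remainder θ F x i i = remainder θ F (fun _ => x i) 0 0 := by
  have : empDistFun x i i = empDistFun (fun _ => x i) 0 0 := by
    ext z
    simp [empDistFun]
  simp [remainder, estimator, this]

/-- `supRemainder` covers only `i < j`. A one-point remainder is a fixed function of one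
observation, so by stationarity its law does not depend on the index, which may therefore vary with
`m`. -/
theorem IsRegime.tendsto_measure_remainder_self
    (hθ : ∀ i j : ℕ, Measurable fun x : ℕ → Fin d → ℝ => estimator θ x i j)
    (hZ : IsRegime θ F Sig Z P) {K : ℕ → ℝ} (hK : Tendsto K atTop atTop) (i : ℕ → ℕ) :
    Tendsto (fun m => P {ω | K m ≤ ‖remainder θ F (fun t => Z t ω) (i m) (i m)‖}) atTop (𝓝 0) := by
  have hg : Measurable fun v : Fin d → ℝ => ‖remainder θ F (fun _ => v) 0 0‖ := by
    simp only [remainder, Finset.Icc_self, Finset.sum_singleton]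
    refine Measurable.norm ((Measurable.sub_const ?_ _).sub
      (hZ.influence_measurable.const_smul (((0 : ℕ) : ℝ) - (0 : ℕ) + 1)⁻¹))
    exact (hθ 0 0).comp (measurable_pi_iff.2 fun _ => measurable_id)
  have hid : ∀ h : ℤ, IdentDistrib (Z 0) (Z h) P P := fun h => by
    have := (hZ.stationary h).comp (measurable_pi_apply (0 : ℤ))
    simpa [Function.comp_def] using this
  refine (tendsto_measure_ge_zero (hg.comp_aemeasurable (hid 0).aemeasurable_fst) hK).congr
    fun m => ?_
  have := (hid (i m)).measure_mem_eq (hg measurableSet_Ici : MeasurableSet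
    ((fun v : Fin d → ℝ => ‖remainder θ F (fun _ => v) 0 0‖) ⁻¹' Set.Ici (K m)))
  simp_rw [remainder_self (F := F) (θ := θ) (fun t : ℕ => Z t _)]
  exact this

theorem le_supRemainder (x : ℕ → Fin d → ℝ) {i j n : ℕ} (hi : 1 ≤ i) (hij : i < j) (hj : j ≤ n) :
    ((j : ℝ) - i + 1) * ‖remainder θ F x i j‖ ≤ supRemainder θ F x n :=
  le_ciSup (f := fun q : {q : Fin (n + 1) × Fin (n + 1) //
      1 ≤ (q.1 : ℕ) ∧ (q.1 : ℕ) < (q.2 : ℕ)} =>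
    (((q.1.2 : ℕ) : ℝ) - ((q.1.1 : ℕ) : ℝ) + 1) * ‖remainder θ F x q.1.1 q.1.2‖)
    (Set.finite_range _).bddAbove
    ⟨(⟨i, by omega⟩, ⟨j, by omega⟩), hi, hij⟩

/-- Restricting to stretches that touch an end of the block leaves just two one-point remainders, at
`l m + 1` and `b m`; all the others are controlled by `supRemainder`. -/
theorem IsRegime.eventually_edgeBound
    (hθ : ∀ i j : ℕ, Measurable fun x : ℕ → Fin d → ℝ => estimator θ x i j)
    (hZ : IsRegime θ F Sig Z P) {l b : ℕ → ℕ} (hb : Tendsto b atTop atTop) {U η : ℝ} (hU : 0 < U)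
    (hbU : ∀ m, (b m : ℝ) ≤ U * m) (hη : 0 < η) {ε : ℝ≥0∞} (hε : 0 < ε) :
    ∀ᶠ m in atTop, P {ω | ¬ EdgeBound θ F (fun t => Z t ω) (l m) (b m) (η * √m)} < ε := by
  have hε3 : 0 < ε / 3 := ENNReal.div_pos hε.ne' (by simp)
  have hK : Tendsto (fun m : ℕ => η * √(m : ℝ)) atTop atTop :=
    (Real.tendsto_sqrt_atTop.comp tendsto_natCast_atTop_atTop).const_mul_atTop hη
  have h₁ := hZ.tendsto_measure_remainder_self hθ hK fun m => l m + 1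
  have h₂ := hZ.tendsto_measure_remainder_self hθ hK b
  -- The level `η / √U` turns the bound in `√(b m) ≤ √(U m)` into `η √m`.
  have h₃ := (hZ.remainder_small (ENNReal.ofReal (η / √U)) (by simp; positivity)).comp hb
  filter_upwards [h₁.eventually (gt_mem_nhds hε3), h₂.eventually (gt_mem_nhds hε3),
    h₃.eventually (gt_mem_nhds hε3), hb.eventually (eventually_gt_atTop 0)] with m h₁ h₂ h₃ hbm
  have hsub : {ω | ¬ EdgeBound θ F (fun t => Z t ω) (l m) (b m) (η * √m)} ⊆
      {ω | η * √m ≤ ‖remainder θ F (fun t => Z t ω) (l m + 1) (l m + 1)‖} ∪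
      {ω | η * √m ≤ ‖remainder θ F (fun t => Z t ω) (b m) (b m)‖} ∪
      {ω | ENNReal.ofReal (η / √U) ≤
        edist (supRemainder θ F (fun t => Z t ω) (b m) / √(b m : ℝ)) 0} := by
    intro ω hω
    by_contra hcon
    simp only [Set.mem_union, Set.mem_ofPred_eq, not_or, not_le] at hcon
    obtain ⟨⟨c₁, c₂⟩, c₃⟩ := hcon
    refine hω fun i j hi hij hj hor => ?_
    rcases hij.eq_or_lt with rfl | hij
    · rw [sub_self, zero_add, one_mul]
      rcases hor with rfl | rfl
      · exact c₁.le
      · exact c₂.le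
    · refine (le_supRemainder _ (by omega) hij hj).trans ?_
      have hsb : 0 < √(b m : ℝ) := Real.sqrt_pos.2 (by exact_mod_cast hbm)
      rw [edist_dist, Real.dist_eq, sub_zero, ENNReal.ofReal_lt_ofReal_iff (by positivity)] at c₃
      have c₄ := (le_abs_self _).trans_lt c₃
      rw [div_lt_iff₀ hsb] at c₄
      refine c₄.le.trans ?_
      calc η / √U * √(b m : ℝ) ≤ η / √U * √(U * m) := by gcongr; exact hbU m
        _ = η * √m := by rw [Real.sqrt_mul hU.le]; field_simp
  refine (measure_mono hsub).trans_lt ((measure_union_le _ _).trans_lt ?_)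
  refine (add_le_add_left (measure_union_le _ _) _).trans_lt ?_
  calc _ < ε / 3 + ε / 3 + ε / 3 := ENNReal.add_lt_add (ENNReal.add_lt_add h₁ h₂) h₃
    _ = ε := ENNReal.add_thirds ε

end Regime

end SeqChange
namespace SeqChange

/-! ### Linear independence of the weighted estimator differences before the change -/

/-- The values of a path on `[0, c]` on the grid of mesh `c / (p + 1)`, in bridge form. -/
noncomputable def pathBridge {p : ℕ} {c : ℝ} (hc : 0 ≤ c) (y : LInf 0 c p) :
    Fin p → EuclideanSpace ℝ (Fin p) :=
  gridBridge p (c / (p + 1)).toNNReal fun t => y (Set.projIcc 0 c hc t)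

theorem continuous_pathBridge {p : ℕ} {c : ℝ} (hc : 0 ≤ c) :
    Continuous (pathBridge hc : LInf 0 c p → _) :=
  continuous_pi fun k => ((continuous_eval_LInf _).const_smul ((p : ℝ) + 1)).sub
    ((continuous_eval_LInf _).const_smul (((k : ℕ) + 1 : ℕ) : ℝ))

theorem coe_grid {p : ℕ} {c : ℝ} (hc : 0 ≤ c) (k : ℕ) :
    (((k : ℝ≥0) * (c / (p + 1)).toNNReal : ℝ≥0) : ℝ) = k * (c / (p + 1)) := by
  rw [NNReal.coe_mul, NNReal.coe_natCast, Real.coe_toNNReal _ (by positivity)]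

theorem grid_mem_Icc {p : ℕ} {c : ℝ} (hc : 0 ≤ c) {k : ℕ} (hk : k ≤ p + 1) :
    (k : ℝ) * (c / (p + 1)) ∈ Set.Icc 0 c := by
  refine ⟨by positivity, ?_⟩
  have : (k : ℝ) ≤ p + 1 := by exact_mod_cast hk
  calc (k : ℝ) * (c / (p + 1)) ≤ (p + 1) * (c / (p + 1)) := by gcongr
    _ = c := by field_simp

theorem pathBridge_apply {p : ℕ} {c : ℝ} (hc : 0 ≤ c) {y : LInf 0 c p}
    {f : ℝ → EuclideanSpace ℝ (Fin p)} (hf : ∀ s : Set.Icc 0 c, y s = f s) (k : Fin p) :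
    pathBridge hc y k = ((p : ℝ) + 1) • f (((k : ℕ) + 1 : ℕ) * (c / (p + 1))) -
      (((k : ℕ) + 1 : ℕ) : ℝ) • f c := by
  have hk : (k : ℕ) + 1 ≤ p + 1 := by omega
  have hlast : ((p + 1 : ℕ) : ℝ) * (c / (p + 1)) = c := by push_cast; field_simp
  rw [pathBridge, gridBridge, hf, hf, Set.coe_projIcc, Set.coe_projIcc, coe_grid hc, coe_grid hc,
    hlast, min_eq_right (grid_mem_Icc hc hk).2, max_eq_right (grid_mem_Icc hc hk).1, min_self,
    max_eq_right hc]

theorem toEuclideanLin_sqrt_injective {p : ℕ} {Sig : Matrix (Fin p) (Fin p) ℝ}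
    (h : Sig.PosDef) : Function.Injective (Matrix.toEuclideanLin (CFC.sqrt Sig)) := by
  have hsq := CFC.sqrt_mul_sqrt_self Sig h.posSemidef.nonneg
  have hu : IsUnit (CFC.sqrt Sig) := by
    have hdet := (Matrix.isUnit_iff_isUnit_det _).1 h.isUnit
    rw [← hsq, Matrix.det_mul] at hdet
    exact (Matrix.isUnit_iff_isUnit_det _).2 (isUnit_of_mul_isUnit_left hdet)
  intro v w hvw
  have h1 : CFC.sqrt Sig *ᵥ v.ofLp = CFC.sqrt Sig *ᵥ w.ofLp := by
    simpa [Matrix.toLpLin_apply] using congrArg WithLp.ofLp hvw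
  exact WithLp.ofLp_injective 2 (Matrix.mulVec_injective_of_isUnit hu h1)

theorem IsBrownianVec.ae_continuous {p : ℕ} {Ω : Type*} [MeasurableSpace Ω] {P : Measure Ω}
    {W : ℝ≥0 → Ω → EuclideanSpace ℝ (Fin p)} (hW : IsBrownianVec W P) :
    ∀ᵐ ω ∂P, Continuous fun t => W t ω := by
  filter_upwards [ae_all_iff.2 fun i => (hW.coord i).cont] with ω hω
  exact (PiLp.continuous_toLp 2 _).comp (continuous_pi hω)

theorem pathBridge_toLInf_comp {p : ℕ} {c : ℝ} (hc : 0 ≤ c)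
    (L : EuclideanSpace ℝ (Fin p) →ₗ[ℝ] EuclideanSpace ℝ (Fin p))
    {g : ℝ≥0 → EuclideanSpace ℝ (Fin p)} (hg : Continuous g) :
    pathBridge hc (toLInf 0 c fun s => L (g s.toNNReal)) =
      L ∘ gridBridge p (c / (p + 1)).toNNReal g := by
  obtain ⟨f, hf⟩ : ∃ f : ℝ → EuclideanSpace ℝ (Fin p), f = fun s => L (g s.toNNReal) := ⟨_, rfl⟩
  have hcont : Continuous f := by
    rw [hf]
    exact L.continuous_of_finiteDimensional.comp (hg.comp continuous_real_toNNReal)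
  have hya := toLInf_apply (memLInf_of_continuousOn (a := 0) (b := c) hcont.continuousOn)
  have hlast : ((p + 1 : ℕ) : ℝ≥0) * (c / (p + 1)).toNNReal = c.toNNReal := by
    rw [← NNReal.coe_inj, coe_grid hc, Real.coe_toNNReal _ hc]
    push_cast
    field_simp
  ext1 k
  have hk : ((((k : ℕ) + 1 : ℕ) : ℝ) * (c / (p + 1))).toNNReal =
      (((k : ℕ) + 1 : ℕ) : ℝ≥0) * (c / (p + 1)).toNNReal := by
    rw [← coe_grid hc, Real.toNNReal_coe]
  have hfa : ∀ s, f s = L (g s.toNNReal) := fun s => by rw [hf]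
  rw [← hf, pathBridge_apply hc hya, hfa, hfa, Function.comp_apply, gridBridge, map_sub, map_smul,
    map_smul, hlast, hk]

theorem ae_linearIndependent_pathBridge_limit {p : ℕ} {Ω : Type*} [MeasurableSpace Ω]
    {P : Measure Ω} [IsProbabilityMeasure P] {W : ℝ≥0 → Ω → EuclideanSpace ℝ (Fin p)}
    (hW : IsBrownianVec W P) {Sig : Matrix (Fin p) (Fin p) ℝ} (hSig : Sig.PosDef) {c : ℝ}
    (hc : 0 < c) :
    ∀ᵐ ω ∂P, LinearIndependent ℝ (pathBridge hc.le
      (toLInf 0 c fun s => Matrix.toEuclideanLin (CFC.sqrt Sig) (W s.toNNReal ω))) := by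
  have hh : 0 < (c / (p + 1)).toNNReal := Real.toNNReal_pos.2 (by positivity)
  filter_upwards [hW.ae_continuous, ae_linearIndependent_gridBridge hW hh] with ω hcont hli
  rw [pathBridge_toLInf_comp hc.le _ hcont]
  exact hli.map' _ (LinearMap.ker_eq_bot.2 (toEuclideanLin_sqrt_injective hSig))

variable {d p : ℕ} {θ : ((Fin d → ℝ) → ℝ) → EuclideanSpace ℝ (Fin p)}

theorem linearIndependent_of_const_smul {ι E : Type*} [AddCommGroup E] [Module ℝ E] {a : ℝ}
    {v : ι → E} (h : LinearIndependent ℝ fun i => a • v i) : LinearIndependent ℝ v :=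
  LinearIndependent.of_comp (a • (LinearMap.id : E →ₗ[ℝ] E)) h

/-- Three errors separate the rescaled block vector from the bridge value: rounding of `z / m`,
rounding of `J / m`, and the remainder. The first two cost at most `K / m` each, the third `2 c η`,
all before division by the mesh `h`. -/
theorem norm_scaled_sub_lt {E : Type*} [NormedAddCommGroup E] [NormedSpace ℝ E] {b u v : E}
    {m h c s z J K η τ : ℝ} (hm : 0 < m) (hh : 0 < h) (hη : 0 ≤ η) (hz : |z / m - c| ≤ 1 / m)
    (hJ : |J / m - s| ≤ 1 / m) (hzc : z ≤ m * c) (hu : ‖u‖ ≤ K) (hv : ‖v‖ ≤ K)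
    (hb : ‖b - (z • √m • u - J • √m • v)‖ ≤ 2 * (z * (η * √m)))
    (hτ : 2 * K / m + 2 * (c * η) < τ * h) :
    ‖(h⁻¹ * (m * √m)⁻¹) • b - ((h⁻¹ * c) • u - (h⁻¹ * s) • v)‖ < τ := by
  have hsm : 0 < √m := Real.sqrt_pos.2 hm
  set e := b - (z • √m • u - J • √m • v) with he
  have hdecomp : (h⁻¹ * (m * √m)⁻¹) • b - ((h⁻¹ * c) • u - (h⁻¹ * s) • v) =
      h⁻¹ • ((z / m - c) • u - (J / m - s) • v + (m * √m)⁻¹ • e) := by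
    rw [eq_add_of_sub_eq he.symm]
    match_scalars <;> field_simp <;> ring
  rw [hdecomp, norm_smul, norm_inv, Real.norm_of_nonneg hh.le, inv_mul_lt_iff₀ hh, mul_comm h τ]
  refine lt_of_le_of_lt ?_ hτ
  have n₁ : ‖(z / m - c) • u‖ ≤ 1 / m * K := by
    rw [norm_smul]
    exact mul_le_mul hz hu (norm_nonneg _) (by positivity)
  have n₂ : ‖(J / m - s) • v‖ ≤ 1 / m * K := by
    rw [norm_smul]
    exact mul_le_mul hJ hv (norm_nonneg _) (by positivity)
  have n₃ : ‖(m * √m)⁻¹ • e‖ ≤ 2 * (c * η) := by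
    rw [norm_smul, Real.norm_of_nonneg (by positivity), inv_mul_le_iff₀ (by positivity)]
    refine hb.trans ?_
    calc 2 * (z * (η * √m)) ≤ 2 * ((m * c) * (η * √m)) := by gcongr
      _ = _ := by ring
  have n₄ := norm_add_le ((z / m - c) • u - (J / m - s) • v) ((m * √m)⁻¹ • e)
  have n₅ := norm_sub_le ((z / m - c) • u) ((J / m - s) • v)
  have n₆ : 2 * K / m = 1 / m * K + 1 / m * K := by ring
  linarith

theorem linearIndependent_blockVec_of_ball_subset {F : (Fin d → ℝ) → ℝ} {x : ℕ → Fin d → ℝ}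
    {m : ℕ} (hm : 0 < m) {c : ℝ} (hc : 0 < c) {K η τ : ℝ} (hη : 0 ≤ η)
    (hE : EdgeBound θ F x 0 ⌊(m : ℝ) * c⌋₊ (η * √m))
    {f : ℝ → EuclideanSpace ℝ (Fin p)} (hf : f = partialSum (fun t => influence θ F (x t)) m 0)
    (hK : ∀ s ∈ Set.Icc 0 c, ‖f s‖ ≤ K)
    (hball : Metric.ball (fun k : Fin p => ((p : ℝ) + 1) • f (((k : ℕ) + 1 : ℕ) * (c / (p + 1))) -
      (((k : ℕ) + 1 : ℕ) : ℝ) • f c) τ ⊆ {v | LinearIndependent ℝ v})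
    (hτ : 2 * K / m + 2 * (c * η) < τ * (c / (p + 1))) :
    LinearIndependent ℝ fun k : Fin p => blockVec θ x 0 ⌊(m : ℝ) * c⌋₊
      ⌊(m : ℝ) * (((k : ℕ) + 1 : ℕ) * (c / (p + 1)))⌋₊ := by
  set h : ℝ := c / (p + 1) with hh
  have hh0 : 0 < h := by positivity
  have hm' : (0 : ℝ) < m := by exact_mod_cast hm
  have hsm : 0 < √(m : ℝ) := Real.sqrt_pos.2 hm'
  set z := ⌊(m : ℝ) * c⌋₊ with hz
  have hK0 : 0 ≤ K := (norm_nonneg _).trans (hK c ⟨hc.le, le_rfl⟩)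
  have hτ0 : 0 < τ := by
    have : 0 < τ * h := lt_of_le_of_lt (by positivity) hτ
    exact pos_of_mul_pos_left this hh0.le
  have hsum : ∀ s, ∑ t ∈ Finset.Ioc 0 ⌊(m : ℝ) * s⌋₊, influence θ F (x t) = √(m : ℝ) • f s :=
    fun s => by rw [hf, partialSum, smul_smul, mul_inv_cancel₀ hsm.ne', one_smul]
  have hfloor : ∀ s : ℝ, 0 ≤ s → |(⌊(m : ℝ) * s⌋₊ : ℝ) / m - s| ≤ 1 / m := fun s hs => by
    have e₁ := Nat.floor_le (a := (m : ℝ) * s) (by positivity)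
    have e₂ := (Nat.lt_floor_add_one ((m : ℝ) * s)).le
    have e₃ : (⌊(m : ℝ) * s⌋₊ : ℝ) / m - s = (⌊(m : ℝ) * s⌋₊ - m * s) / m := by field_simp
    rw [e₃, abs_div, abs_of_pos hm']
    gcongr
    rw [abs_le]
    constructor <;> linarith
  have hzc : (z : ℝ) ≤ m * c := Nat.floor_le (by positivity)
  have hmem : (fun k : Fin p => (h⁻¹ * (m * √m)⁻¹) • blockVec θ x 0 z
      ⌊(m : ℝ) * (((k : ℕ) + 1 : ℕ) * h)⌋₊) ∈ Metric.ball (fun k : Fin p =>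
        ((p : ℝ) + 1) • f (((k : ℕ) + 1 : ℕ) * h) - (((k : ℕ) + 1 : ℕ) : ℝ) • f c) τ := by
    rw [Metric.mem_ball, dist_pi_lt_iff hτ0]
    intro k
    obtain ⟨s, hs⟩ : ∃ s : ℝ, s = ((k : ℕ) + 1 : ℕ) * h := ⟨_, rfl⟩
    have hsI : s ∈ Set.Icc 0 c := hs ▸ grid_mem_Icc hc.le (by omega)
    have hJz : ⌊(m : ℝ) * s⌋₊ ≤ z := Nat.floor_le_floor (by gcongr; exact hsI.2)
    have hE' := norm_blockVec_sub_le (by positivity) hE (Nat.zero_le _) hJz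
    rw [hsum, hz, hsum, ← hz, Nat.cast_zero, sub_zero, sub_zero] at hE'
    -- Measured in units of the mesh, the end point `c` and the grid point `s` become the integer
    -- coefficients of the bridge.
    have hp1 : (p : ℝ) + 1 = h⁻¹ * c := by rw [hh]; field_simp
    have hk1 : (((k : ℕ) + 1 : ℕ) : ℝ) = h⁻¹ * s := by rw [hs]; field_simp
    rw [← hs, dist_eq_norm, hk1, hp1]
    refine norm_scaled_sub_lt hm' hh0 hη (hfloor c hc.le) (hfloor s hsI.1) hzc (hK s hsI)
      (hK c ⟨hc.le, le_rfl⟩) hE' hτ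
  exact linearIndependent_of_const_smul (hball hmem)

/-! ### Good blocks have high probability -/

section Regime

variable {Ω : Type*} [MeasurableSpace Ω] {P : Measure Ω} [IsProbabilityMeasure P]
  {F : (Fin d → ℝ) → ℝ} {Sig : Matrix (Fin p) (Fin p) ℝ} {Z : ℤ → Ω → Fin d → ℝ}
  {Ω' : Type*} [MeasurableSpace Ω'] {P' : Measure Ω'} [IsProbabilityMeasure P']

/-- Tightness of `Q` bounds the influence sums by `K √m`, and `IsRegime.eventually_edgeBound` bounds
the remainders by `√m`. The estimation error is then of order `√m` divided by a block length of at
least `κ m`. -/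
theorem IsRegime.exists_eventually_blockGood
    (hθ : ∀ i j : ℕ, Measurable fun x : ℕ → Fin d → ℝ => estimator θ x i j)
    (hZ : IsRegime θ F Sig Z P) {l b : ℕ → ℕ} {U κ δ : ℝ} (hU : 0 < U)
    (hbU : ∀ m, (b m : ℝ) ≤ U * m) (hκ : 0 < κ)
    (hbl : ∀ᶠ m : ℕ in atTop, κ * m ≤ (b m : ℝ) - l m) (hδ : 0 < δ) {Q : ℕ → Ω → ℝ} {Y : Ω' → ℝ}
    (hQ : TendstoWeakly Q Y P P')
    (hS : ∀ m ω i, 0 < m → l m ≤ i → i ≤ b m →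
      ‖∑ t ∈ Finset.Ioc (l m) i, influence θ F (Z t ω)‖ ≤ Q m ω * √m)
    {ε : ℝ≥0∞} (hε : 0 < ε) :
    ∃ C : ℝ, 0 < C ∧ ∀ᶠ m : ℕ in atTop,
      P {ω | (fun t : ℕ => Z t ω) ∉ blockGood θ F (l m) (b m) (C * (m * √m)) δ} < ε := by
  have hε2 : 0 < ε / 2 := ENNReal.half_pos hε.ne'
  obtain ⟨K, hK, hKev⟩ := hQ.exists_eventually_measure_ge_lt hε2
  have hb : Tendsto b atTop atTop := by
    rw [← tendsto_natCast_atTop_iff (R := ℝ)]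
    refine tendsto_atTop_mono' _ ?_ (tendsto_natCast_atTop_atTop.const_mul_atTop hκ)
    filter_upwards [hbl] with m hm
    linarith [Nat.cast_nonneg (α := ℝ) (l m)]
  have hsqrt : Tendsto (fun m : ℕ => δ * κ * √(m : ℝ)) atTop atTop :=
    (Real.tendsto_sqrt_atTop.comp tendsto_natCast_atTop_atTop).const_mul_atTop (by positivity)
  refine ⟨2 * U * (K + 1), by positivity, ?_⟩
  filter_upwards [hKev, hZ.eventually_edgeBound hθ (l := l) hb hU hbU one_pos hε2, hbl,
    hsqrt.eventually_ge_atTop (K + 1), eventually_gt_atTop 0] with m h₁ h₂ h₃ h₄ hm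
  have hm' : (0 : ℝ) < m := by exact_mod_cast hm
  have hsub : {ω | (fun t : ℕ => Z t ω) ∉
      blockGood θ F (l m) (b m) (2 * U * (K + 1) * (m * √m)) δ} ⊆
      {ω | K ≤ Q m ω} ∪ {ω | ¬ EdgeBound θ F (fun t => Z t ω) (l m) (b m) (1 * √m)} := by
    intro ω hω
    by_contra hcon
    simp only [Set.mem_union, Set.mem_ofPred_eq, not_or, not_le, not_not, one_mul] at hcon
    have hlb : (0 : ℝ) < (b m : ℝ) - l m := lt_of_lt_of_le (by positivity) h₃
    refine hω (mem_blockGood hK.le hcon.2 (by exact_mod_cast sub_pos.1 hlb) ?_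
      (fun i hli hib => (hS m ω i hm hli hib).trans (by gcongr; exact hcon.1.le)) ?_)
    · linarith [hbU m, Nat.cast_nonneg (α := ℝ) (l m)]
    · calc (K + 1) * √m ≤ δ * κ * √m * √m := by gcongr
        _ = δ * (κ * m) := by rw [mul_assoc, Real.mul_self_sqrt hm'.le, mul_assoc]
        _ ≤ _ := by gcongr
  refine (measure_mono hsub).trans_lt ((measure_union_le _ _).trans_lt ?_)
  calc _ < ε / 2 + ε / 2 := ENNReal.add_lt_add h₁ h₂
    _ = ε := ENNReal.add_halves ε

theorem IsRegime.eventually_linearIndependent_blockVec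
    (hθ : ∀ i j : ℕ, Measurable fun x : ℕ → Fin d → ℝ => estimator θ x i j)
    (hZ : IsRegime θ F Sig Z P) {c : ℝ} (hc : 0 < c) {W : ℝ≥0 → Ω' → EuclideanSpace ℝ (Fin p)}
    (hW : IsBrownianVec W P')
    (hweak : TendstoWeakly
      (fun m ω => toLInf 0 c (partialSum (fun t => influence θ F (Z t ω)) m 0))
      (fun ω => toLInf 0 c fun s => Matrix.toEuclideanLin (CFC.sqrt Sig) (W s.toNNReal ω)) P P')
    {ε : ℝ≥0∞} (hε : 0 < ε) :
    ∀ᶠ m : ℕ in atTop, P {ω | ¬ LinearIndependent ℝ fun k : Fin p =>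
      blockVec θ (fun t => Z t ω) 0 ⌊(m : ℝ) * c⌋₊
        ⌊(m : ℝ) * (((k : ℕ) + 1 : ℕ) * (c / (p + 1)))⌋₊} < ε := by
  have hε3 : 0 < ε / 3 := ENNReal.div_pos hε.ne' (by simp)
  -- Passing first to finitely many bridge values moves the argument from `ℓ^∞` into a proper space,
  -- where the compactness argument applies.
  obtain ⟨τ, hτ, hτev⟩ := (hweak.comp_continuous
    (continuous_pathBridge hc.le)).exists_eventually_ball_subset
      (isOpen_setOfPred_linearIndependent (𝕜 := ℝ))
      (ae_linearIndependent_pathBridge_limit hW hZ.posDef hc) hε3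
  obtain ⟨K, hK, hKev⟩ := (hweak.comp_continuous continuous_norm).exists_eventually_measure_ge_lt hε3
  set h : ℝ := c / (p + 1) with hh
  have hh0 : 0 < h := by positivity
  -- This makes the remainder error `2 c η` half of the margin `τ h`; the rounding error `2 K / m`
  -- takes the other half for large `m`.
  set η : ℝ := τ * h / (4 * c) with hη
  have hη0 : 0 < η := by positivity
  have hbU : ∀ m : ℕ, (⌊(m : ℝ) * c⌋₊ : ℝ) ≤ c * m := fun m =>
    (Nat.floor_le (by positivity)).trans (mul_comm _ _).le
  have hb : Tendsto (fun m : ℕ => ⌊(m : ℝ) * c⌋₊) atTop atTop :=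
    tendsto_nat_floor_atTop.comp (tendsto_natCast_atTop_atTop.atTop_mul_const hc)
  have hlim : Tendsto (fun m : ℕ => 2 * K / (m : ℝ)) atTop (𝓝 0) :=
    tendsto_const_div_atTop_nhds_zero_nat _
  filter_upwards [hτev, hKev, hZ.eventually_edgeBound hθ (l := fun _ => 0) hb hc hbU hη0 hε3,
    hlim.eventually (gt_mem_nhds (show 0 < τ * h / 2 by positivity)), eventually_gt_atTop 0]
    with m h₁ h₂ h₃ h₄ hm
  have hsub : {ω | ¬ LinearIndependent ℝ fun k : Fin p =>
      blockVec θ (fun t => Z t ω) 0 ⌊(m : ℝ) * c⌋₊ ⌊(m : ℝ) * (((k : ℕ) + 1 : ℕ) * h)⌋₊} ⊆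
      {ω | ¬ Metric.ball (pathBridge hc.le
        (toLInf 0 c (partialSum (fun t => influence θ F (Z t ω)) m 0))) τ ⊆
        {v | LinearIndependent ℝ v}} ∪
      {ω | K ≤ ‖toLInf 0 c (partialSum (fun t => influence θ F (Z t ω)) m 0)‖} ∪
      {ω | ¬ EdgeBound θ F (fun t => Z t ω) 0 ⌊(m : ℝ) * c⌋₊ (η * √m)} := by
    intro ω hω
    by_contra hcon
    simp only [Set.mem_union, Set.mem_ofPred_eq, not_or, not_le, not_not] at hcon
    have hya := toLInf_apply (memLInf_partialSum (a := 0) (b := c)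
      (fun t => influence θ F (Z t ω)) m 0)
    have hpb : pathBridge hc.le (toLInf 0 c (partialSum (fun t => influence θ F (Z t ω)) m 0)) =
        fun k : Fin p => ((p : ℝ) + 1) • partialSum (fun t => influence θ F (Z t ω)) m 0
          (((k : ℕ) + 1 : ℕ) * (c / (p + 1))) - (((k : ℕ) + 1 : ℕ) : ℝ) •
          partialSum (fun t => influence θ F (Z t ω)) m 0 c :=
      funext fun k => pathBridge_apply hc.le hya k
    refine hω (linearIndependent_blockVec_of_ball_subset hm hc hη0.le hcon.2 rfl
      (K := K) (fun s hs => ?_) (hpb ▸ hcon.1.1) ?_)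
    · rw [← hya ⟨s, hs⟩]
      exact (lp.norm_apply_le_norm ENNReal.top_ne_zero _ _).trans hcon.1.2.le
    have : 2 * (c * η) = τ * h / 2 := by rw [hη]; field_simp; norm_num
    rw [this, ← hh]
    linarith
  refine (measure_mono hsub).trans_lt ((measure_union_le _ _).trans_lt ?_)
  refine (add_le_add_left (measure_union_le _ _) _).trans_lt ?_
  calc _ < ε / 3 + ε / 3 + ε / 3 := ENNReal.add_lt_add (ENNReal.add_lt_add h₁ h₂) h₃
    _ = ε := ENNReal.add_thirds ε

end Regime

end SeqChange
namespace SeqChange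

/-! ### Detection of the change -/

/-- Counting powers: `m · m² · m²` over `m · m³` leaves linear growth in `m`. -/
theorem mul_le_scaled_detector_bound {m z u M C κ δ U : ℝ} (hm : 0 < m) (hz : m ≤ z) (hκ : 0 ≤ κ)
    (hzu : κ * m ≤ u - z) (hu : 0 < u) (huU : u ≤ U * m) (hC : 0 < C) (hM : M = C * (m * √m)) :
    κ ^ 2 * δ ^ 2 / (U * C ^ 2) * m ≤ m * (z ^ 2 * (u - z) ^ 2 * (δ ^ 2 / (u * M ^ 2))) := by
  have hU : 0 < U := pos_of_mul_pos_left (hu.trans_le huU) hm.le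
  have hM2 : M ^ 2 = C ^ 2 * m ^ 3 := by
    rw [hM, mul_pow, mul_pow, Real.sq_sqrt hm.le]
    ring
  calc κ ^ 2 * δ ^ 2 / (U * C ^ 2) * m
      = m * (m ^ 2 * (κ * m) ^ 2 * (δ ^ 2 / (U * m * M ^ 2))) := by
        rw [hM2]; field_simp
    _ ≤ _ := by
        have hMpos : 0 < M ^ 2 := by rw [hM2]; positivity
        gcongr

theorem one_lt_maxDetectorSN {d p : ℕ} {θ : ((Fin d → ℝ) → ℝ) → EuclideanSpace ℝ (Fin p)}
    {F₁ F₂ : (Fin d → ℝ) → ℝ} {T c : ℝ} (hT : 0 ≤ T) {w : ℝ → ℝ}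
    (hwpos : ∀ x ∈ Set.Icc 0 T, 0 < w x) (hwmono : MonotoneOn w (Set.Icc 0 T))
    {x : ℕ → Fin d → ℝ} {m : ℕ} (hm : 0 < m) {C κ δ : ℝ} (hC : 0 < C) (hκ : 0 < κ) (hδ : 0 < δ)
    (hne : 3 * δ ≤ ‖θ F₁ - θ F₂‖) (hmz : m ≤ ⌊(m : ℝ) * c⌋₊)
    (hzu : κ * m ≤ (⌊(m : ℝ) * (T + 1)⌋₊ : ℝ) - ⌊(m : ℝ) * c⌋₊)
    (h₁ : x ∈ blockGood θ F₁ 0 ⌊(m : ℝ) * c⌋₊ (C * (m * √m)) δ)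
    (h₂ : x ∈ blockGood θ F₂ ⌊(m : ℝ) * c⌋₊ ⌊(m : ℝ) * (T + 1)⌋₊ (C * (m * √m)) δ)
    (J : Fin p → ℕ) (hJ : ∀ k, J k ≤ ⌊(m : ℝ) * c⌋₊)
    (hli : LinearIndependent ℝ fun k => blockVec θ x 0 ⌊(m : ℝ) * c⌋₊ (J k))
    (hlarge : w T < κ ^ 2 * δ ^ 2 / ((T + 1) * C ^ 2) * m) :
    1 < maxDetectorSN θ w T x m := by
  have hm' : (0 : ℝ) < m := by exact_mod_cast hm
  set z := ⌊(m : ℝ) * c⌋₊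
  set k := ⌊(m : ℝ) * T⌋₊ with hk
  have hu : ⌊(m : ℝ) * (T + 1)⌋₊ = m + k := by
    rw [mul_add, mul_one, Nat.floor_add_natCast (by positivity), add_comm]
  rw [hu] at hzu h₂
  have hzk : z < m + k := by
    have : (z : ℝ) < (m + k : ℕ) := by
      have : 0 < κ * m := by positivity
      linarith
    exact_mod_cast this
  -- An index `0` would give a zero block vector, which independence excludes.
  have hJ1 : ∀ i, J i ∈ Finset.Icc 1 z := fun i => by
    refine Finset.mem_Icc.2 ⟨Nat.one_le_iff_ne_zero.2 fun h0 => hli.ne_zero i ?_, hJ i⟩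
    simp [blockVec, h0]
  have hdiff : δ ≤ ‖estimator θ x 1 z - estimator θ x (z + 1) (m + k)‖ := by
    have e₁ : ‖estimator θ x 1 z - θ F₁‖ ≤ δ := h₁.2
    have e₂ := h₂.2
    have := norm_sub_le_norm_sub_add_norm_sub (θ F₁) (estimator θ x 1 z) (θ F₂)
    have := norm_sub_le_norm_sub_add_norm_sub (estimator θ x 1 z)
      (estimator θ x (z + 1) (m + k)) (θ F₂)
    rw [norm_sub_rev] at e₁
    linarith
  have hD := le_detectorSN θ hmz hzk (M := C * (m * √m)) (by positivity) hδ.le J hJ1 hli h₁.1 h₂.1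
    hdiff
  have hkT : (k : ℝ) / m ∈ Set.Icc 0 T :=
    ⟨by positivity, (div_le_iff₀' hm').2 (Nat.floor_le (by positivity))⟩
  have huU : ((m + k : ℕ) : ℝ) ≤ (T + 1) * m := by
    rw [← hu, mul_comm]
    exact Nat.floor_le (by positivity)
  have hlow := mul_le_scaled_detector_bound (δ := δ) (z := z) hm' (by exact_mod_cast hmz) hκ.le hzu
    (by exact_mod_cast (by omega : 0 < m + k)) huU hC rfl
  refine lt_of_lt_of_le ?_ (le_maxDetectorSN θ x w T (k := k) (by omega) le_rfl)
  rw [one_lt_div (hwpos _ hkT)]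
  exact (hwmono hkT ⟨hT, le_rfl⟩ hkT.2).trans_lt (hlarge.trans_le (hlow.trans hD))

end SeqChange

/-! ### Consistency of the monitoring scheme -/

theorem mainTheorem5 {d p : ℕ}
    -- the functional of interest; its estimators are measurable functions of the data
    (θ : ((Fin d → ℝ) → ℝ) → EuclideanSpace ℝ (Fin p))
    (hθ : ∀ i j : ℕ, Measurable fun x : ℕ → Fin d → ℝ => SeqChange.estimator θ x i j)
    -- monitoring horizon and position of the change
    (T c : ℝ) (hc : 1 < c) (hcT : c < T + 1)
    -- the stationary regimes before and after the change
    {Ω' : Type*} [MeasurableSpace Ω'] (P' : Measure Ω') [IsProbabilityMeasure P']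
    (Z₁ Z₂ : ℤ → Ω' → Fin d → ℝ) (F₁ F₂ : (Fin d → ℝ) → ℝ)
    (Sig₁ Sig₂ : Matrix (Fin p) (Fin p) ℝ)
    (hZ₁ : SeqChange.IsRegime θ F₁ Sig₁ Z₁ P') (hZ₂ : SeqChange.IsRegime θ F₂ Sig₂ Z₂ P')
    (hne : θ F₁ ≠ θ F₂)
    -- joint weak convergence of the partial sum processes of the two regimes
    {Ω'' : Type*} [MeasurableSpace Ω''] (P'' : Measure Ω'') [IsProbabilityMeasure P'']
    (W₁ W₂ : ℝ≥0 → Ω'' → EuclideanSpace ℝ (Fin p))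
    (hW₁ : SeqChange.IsBrownianVec W₁ P'') (hW₂ : SeqChange.IsBrownianVec W₂ P'')
    (hweak : SeqChange.TendstoWeakly (SeqChange.partialSumPair θ F₁ F₂ Z₁ Z₂ c T)
      (SeqChange.limitPair Sig₁ Sig₂ W₁ W₂ c T) P' P'')
    -- the observations: a triangular array with a change after time `⌊m c⌋`
    {Ω : ℕ → Type*} [∀ m, MeasurableSpace (Ω m)] (P : ∀ m, Measure (Ω m))
    [∀ m, IsProbabilityMeasure (P m)] (X : ∀ m, ℕ → Ω m → Fin d → ℝ)
    (hX₁ : ∀ m : ℕ, IdentDistrib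
      (fun ω (t : Finset.Icc 1 ⌊(m : ℝ) * c⌋₊) => X m t ω)
      (fun ω (t : Finset.Icc 1 ⌊(m : ℝ) * c⌋₊) => Z₁ (t : ℕ) ω) (P m) P')
    (hX₂ : ∀ m : ℕ, IdentDistrib
      (fun ω (t : Finset.Icc (⌊(m : ℝ) * c⌋₊ + 1) ⌊(m : ℝ) * (T + 1)⌋₊) => X m t ω)
      (fun ω (t : Finset.Icc (⌊(m : ℝ) * c⌋₊ + 1) ⌊(m : ℝ) * (T + 1)⌋₊) => Z₂ (t : ℕ) ω) (P m) P')
    -- the threshold function of level `α`, where `W` is a standard Brownian motion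
    (α : ℝ) (hα : α ∈ Set.Ioo (0 : ℝ) 1)
    (w : ℝ → ℝ) (hwpos : ∀ x ∈ Set.Icc 0 T, 0 < w x) (hwmono : MonotoneOn w (Set.Icc 0 T))
    {Ω₀ : Type*} [MeasurableSpace Ω₀] (P₀ : Measure Ω₀) [IsProbabilityMeasure P₀]
    (W : ℝ≥0 → Ω₀ → EuclideanSpace ℝ (Fin p)) (hW : SeqChange.IsBrownianVec W P₀)
    (hw : P₀ {ω | 1 < SeqChange.supBTilde (fun t => W t ω) w T} = ENNReal.ofReal α) :
    Tendsto
      (fun m : ℕ => P m {ω | 1 < SeqChange.maxDetectorSN θ w T (fun t => X m t ω) m})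
      atTop (𝓝 1) := by
  have hT : 0 < T := by linarith
  have hc0 : 0 < c := by linarith
  have hpaths₁ : SeqChange.TendstoWeakly
      (fun m ω => SeqChange.toLInf 0 c
        (SeqChange.partialSum (fun t => SeqChange.influence θ F₁ (Z₁ t ω)) m 0))
      (fun ω => SeqChange.toLInf 0 c fun s =>
        Matrix.toEuclideanLin (CFC.sqrt Sig₁) (W₁ s.toNNReal ω)) P' P'' :=
    hweak.comp_continuous continuous_fst
  have hnorm₂ : SeqChange.TendstoWeakly
      (fun m ω => ‖SeqChange.toLInf c (T + 1) (SeqChange.partialSum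
        (fun t => SeqChange.influence θ F₂ (Z₂ t ω)) m ⌊(m : ℝ) * c⌋₊)‖)
      (fun ω => ‖(SeqChange.limitPair Sig₁ Sig₂ W₁ W₂ c T ω).2‖) P' P'' :=
    hweak.comp_continuous continuous_snd.norm
  have hz : ∀ m : ℕ, (⌊(m : ℝ) * c⌋₊ : ℝ) ≤ c * m := fun m =>
    (Nat.floor_le (by positivity)).trans (mul_comm _ _).le
  have hu : ∀ m : ℕ, (⌊(m : ℝ) * (T + 1)⌋₊ : ℝ) ≤ (T + 1) * m := fun m =>
    (Nat.floor_le (by positivity)).trans (mul_comm _ _).le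
  have hmz : ∀ m : ℕ, m ≤ ⌊(m : ℝ) * c⌋₊ := fun m => Nat.le_floor (by
    nlinarith [Nat.cast_nonneg (α := ℝ) m])
  -- Half of the limiting relative length of the post-change block; the other half absorbs the
  -- rounding error.
  obtain ⟨κ, hκ⟩ : ∃ κ : ℝ, κ = (T + 1 - c) / 2 := ⟨_, rfl⟩
  have hκ0 : 0 < κ := by linarith
  have hgap : ∀ᶠ m : ℕ in atTop, κ * m ≤ (⌊(m : ℝ) * (T + 1)⌋₊ : ℝ) - ⌊(m : ℝ) * c⌋₊ := by
    filter_upwards [(tendsto_natCast_atTop_atTop.const_mul_atTop hκ0).eventually_ge_atTop (1 : ℝ)]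
      with m hm
    have e₁ := (Nat.lt_floor_add_one ((m : ℝ) * (T + 1))).le
    have e₂ := hz m
    have e₃ : 2 * (κ * m) = m * (T + 1) - c * m := by rw [hκ]; ring
    linarith
  -- Two estimation errors of at most a third of the jump leave a third of it as the difference of
  -- the estimators.
  obtain ⟨δ, hδ⟩ : ∃ δ : ℝ, δ = ‖θ F₁ - θ F₂‖ / 3 := ⟨_, rfl⟩
  have hδ0 : 0 < δ := by
    have := norm_pos_iff.2 (sub_ne_zero.2 hne)
    linarith
  refine (ENNReal.tendsto_nhds ENNReal.one_ne_top).2 fun ε hε => ?_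
  have hε3 : 0 < ε / 3 := ENNReal.div_pos hε.ne' (by simp)
  obtain ⟨C₁, hC₁, hev₁⟩ := hZ₁.exists_eventually_blockGood hθ (l := fun _ => 0)
    (b := fun m => ⌊(m : ℝ) * c⌋₊) hc0 hz one_pos
    (Eventually.of_forall fun m => by simpa using hmz m) hδ0
    (hpaths₁.comp_continuous continuous_norm)
    (fun m ω i hm _ hi => SeqChange.norm_sum_Ioc_le _ hm (Or.inr (by simp))
      ((Nat.le_floor_iff (by positivity)).1 hi)) hε3
  obtain ⟨C₂, hC₂, hev₂⟩ := hZ₂.exists_eventually_blockGood hθ (l := fun m => ⌊(m : ℝ) * c⌋₊)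
    (b := fun m => ⌊(m : ℝ) * (T + 1)⌋₊) (by linarith : 0 < T + 1) hu hκ0 hgap hδ0 hnorm₂
    (fun m ω i hm hli hi => SeqChange.norm_sum_Ioc_le _ hm
      (hli.eq_or_lt.imp Eq.symm fun h => (Nat.lt_of_floor_lt h).le)
      ((Nat.le_floor_iff (by positivity)).1 hi)) hε3
  have hev₃ := hZ₁.eventually_linearIndependent_blockVec hθ hc0 hW₁ hpaths₁ hε3
  have hC : 0 < C₁ + C₂ := by positivity
  have hlarge : Tendsto (fun m : ℕ => κ ^ 2 * δ ^ 2 / ((T + 1) * (C₁ + C₂) ^ 2) * (m : ℝ))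
      atTop atTop := tendsto_natCast_atTop_atTop.const_mul_atTop (by positivity)
  filter_upwards [hev₁, hev₂, hev₃, hgap, hlarge.eventually_gt_atTop (w T),
    eventually_gt_atTop 0] with m h₁ h₂ h₃ h₄ h₅ hm
  refine ⟨?_, prob_le_one.trans le_self_add⟩
  obtain ⟨J, hJ⟩ : ∃ J : Fin p → ℕ,
    J = fun k : Fin p => ⌊(m : ℝ) * (((k : ℕ) + 1 : ℕ) * (c / (p + 1)))⌋₊ := ⟨_, rfl⟩
  have hJz : ∀ k, J k ≤ ⌊(m : ℝ) * c⌋₊ := fun k => by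
    rw [hJ]
    exact Nat.floor_le_floor (mul_le_mul_of_nonneg_left
      (SeqChange.grid_mem_Icc hc0.le (by omega)).2 (Nat.cast_nonneg _))
  have hmeasLI : MeasurableSet {x : ℕ → Fin d → ℝ | LinearIndependent ℝ fun k =>
      SeqChange.blockVec θ x 0 ⌊(m : ℝ) * c⌋₊ (J k)} :=
    (measurable_pi_iff.2 fun k => SeqChange.measurable_blockVec hθ 0 ⌊(m : ℝ) * c⌋₊ (J k))
      (isOpen_setOfPred_linearIndependent (𝕜 := ℝ)).measurableSet
  have t₁ := SeqChange.measure_mem_eq_of_block (Y := fun t : ℕ => Z₁ t) (hX₁ m)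
    (SeqChange.measurableSet_blockGood hθ F₁ 0 ⌊(m : ℝ) * c⌋₊ (C₁ * (m * √m)) δ).compl
    fun x y hxy => not_congr (SeqChange.mem_blockGood_congr (by simpa using hxy))
  have t₂ := SeqChange.measure_mem_eq_of_block (Y := fun t : ℕ => Z₂ t) (hX₂ m)
    (SeqChange.measurableSet_blockGood hθ F₂ ⌊(m : ℝ) * c⌋₊ ⌊(m : ℝ) * (T + 1)⌋₊
      (C₂ * (m * √m)) δ).compl
    fun x y hxy => not_congr (SeqChange.mem_blockGood_congr hxy)
  have t₃ := SeqChange.measure_mem_eq_of_block (Y := fun t : ℕ => Z₁ t) (hX₁ m) hmeasLI.compl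
    fun x y hxy => not_congr (by
      have : (fun k => SeqChange.blockVec θ x 0 ⌊(m : ℝ) * c⌋₊ (J k)) =
          fun k => SeqChange.blockVec θ y 0 ⌊(m : ℝ) * c⌋₊ (J k) :=
        funext fun k => SeqChange.blockVec_congr (by simpa using hxy) ⟨Nat.zero_le _, hJz k⟩
      rw [Set.mem_ofPred_eq, Set.mem_ofPred_eq, this])
  -- Without detection, at least one good event fails. Each failure is determined by a single block,
  -- so its probability is computed under the law of the corresponding regime. `C₁ + C₂` serves as
  -- the common bound for both blocks.
  have hcover : Set.univ ⊆ {ω | 1 < SeqChange.maxDetectorSN θ w T (fun t => X m t ω) m} ∪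
      ({ω | (fun t => X m t ω) ∈ (SeqChange.blockGood θ F₁ 0 ⌊(m : ℝ) * c⌋₊
        (C₁ * (m * √m)) δ)ᶜ} ∪
      {ω | (fun t => X m t ω) ∈ (SeqChange.blockGood θ F₂ ⌊(m : ℝ) * c⌋₊
        ⌊(m : ℝ) * (T + 1)⌋₊ (C₂ * (m * √m)) δ)ᶜ} ∪
      {ω | (fun t => X m t ω) ∈ {x : ℕ → Fin d → ℝ | LinearIndependent ℝ fun k =>
        SeqChange.blockVec θ x 0 ⌊(m : ℝ) * c⌋₊ (J k)}ᶜ}) := by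
    intro ω _
    by_contra hcon
    simp only [Set.mem_union, Set.mem_ofPred_eq, not_or, Set.mem_compl_iff, not_not] at hcon
    obtain ⟨h0, ⟨g₁, g₂⟩, g₃⟩ := hcon
    have hmono : ∀ {F : (Fin d → ℝ) → ℝ} {l b : ℕ} {C : ℝ} {x : ℕ → Fin d → ℝ}, C ≤ C₁ + C₂ →
        x ∈ SeqChange.blockGood θ F l b (C * (m * √m)) δ →
        x ∈ SeqChange.blockGood θ F l b ((C₁ + C₂) * (m * √m)) δ := fun hle hx =>
      ⟨fun j hj => (hx.1 j hj).trans (by gcongr), hx.2⟩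
    exact h0 (SeqChange.one_lt_maxDetectorSN hT.le hwpos hwmono hm hC hκ0 hδ0 (by linarith)
      (hmz m) h₄ (hmono (by linarith) g₁) (hmono (by linarith) g₂) J hJz g₃ h₅)
  rw [hJ] at t₃ hcover
  rw [tsub_le_iff_right]
  calc (1 : ℝ≥0∞) = P m Set.univ := measure_univ.symm
    _ ≤ _ := measure_mono hcover
    _ ≤ _ := measure_union_le _ _
    _ ≤ _ := add_le_add_right ((measure_union_le _ _).trans
      (add_le_add_left (measure_union_le _ _) _)) _
    _ ≤ P m {ω | 1 < SeqChange.maxDetectorSN θ w T (fun t => X m t ω) m} +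
        (ε / 3 + ε / 3 + ε / 3) := by
      rw [t₁, t₂, t₃]
      exact add_le_add_right (add_le_add (add_le_add h₁.le h₂.le) h₃.le) _
    _ = _ := by rw [ENNReal.add_thirds]
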